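/- Let $N\ge 1$, $0\le a,b<N$ and $k\ge 2$ be integers, with $(a,b)\ne(0,0)$ if $k=2$, and let $$H_k^{(a,b)}(\tau)=\sum_{(m,n)\in\mathbb Z^2\setminus\{(0,0)\}}\frac{e^{2\pi i(mb-na)/N}}{(m\tau+n)^k},\qquad \operatorname{Im}\tau>0,$$ where for $k=2$ the sum is taken first over $n$ and then over $m$. For a function $f$ on the upper half-plane with limit $a_0(f)$ at $i\infty$ and an integer $p\ge 0$ put $$\int_{\tau}^{\vec 1_\infty}f(z)z^p\,dz:=-\frac{a_0(f)\,\tau^{p+1}}{p+1}+\int_\tau^{i\infty}\big(f(z)-a_0(f)\big)z^p\,dz .$$ For $1\le l<k$ let the completed $L$-value of $f$ (of weight $k$) be the regularised integral $\Lambda(f,l)=\int_{\vec 1_0}^{\vec 1_\infty}f(\tau)\tau^{l-1}d\tau$, that is, $$\Lambda(f,l)=(-1)^l\int_{i}^{\vec 1_\infty}f|S(\sigma)\,\sigma^{k-l-1}\,d\sigma+\int_i^{\vec 1_\infty}f(\tau)\,\tau^{l-1}\,d\tau,\qquad f|S(\sigma)=\sigma^{-k}f(-1/\sigma),$$ where the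 first term is the integral from the tangent vector $\vec 1_0$ at the cusp $0$ to $i$, transformed by $\tau=-1/\sigma$. Let $B_n(x)$ be the Bernoulli polynomials, $\frac{te^{xt}}{e^t-1}=\sum_{n\ge0}B_n(x)\frac{t^n}{n!}$, and let $\mathrm{Cl}_m(x)$ be the real part (for $m$ odd) or the imaginary part (for $m$ even) of $\sum_{n\ge 1}e^{inx}/n^m$. Let $\kappa\in\{0,1\}$ with $\kappa\equiv k \pmod 2$. Then for every integer $1\le l<k$ the integrals defining $\Lambda(H_k^{(a,b)},l)$ converge, and: 1. if $a=0$ and $l=k-1$: $$\Lambda\big(H_k^{(0,b)},k-1\big)=\frac{2\pi i}{k-1}\,i^{\kappa}\,\mathrm{Cl}_{k-1}\!\left(\tfrac{2\pi b}{N}\right);$$ 2. if $b=0$ and $l=1$: $$\Lambda\big(H_k^{(a,0)},1\big)=(-1)^{k+1}\,\frac{2\pi i}{k-1}\,i^{\kappa}\,\mathrm{Cl}_{k-1}\!\left(\tfrac{2\pi a}{N}\right);$$ 3. in all other cases: $$\Lambda\big(H_k^{(a,b)},l\big)=(-1)^{k+l}\,\frac{(2\pi i)^k}{(k-1)!}\,\frac{B_{k-l}\!\left(\tfrac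 aN\right)}{k-l}\,\frac{B_l\!\left(\tfrac bN\right)}{l}.$$ -/

import Mathlib

open UpperHalfPlane Filter Topology MeasureTheory
open scoped ModularForm

namespace EisensteinLValues

/-- The summand `μ_N ^ (u|v) / (m τ + n) ^ k` with `u = (m, n)`, `v = (a, b)`, `μ_N = e ^ (2πi/N)`
and the symplectic pairing `(u|v) = m b - n a`; the term `u = (0, 0)` is left out. -/
noncomputable def hTerm (N : ℕ) (a b : ℤ) (k : ℕ) (τ : ℍ) (m n : ℤ) : ℂ :=
  if m = 0 ∧ n = 0 then 0
  else Complex.exp (2 * Real.pi * Complex.I * ((m * b - n * a : ℤ) : ℂ) / N)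
    / ((m : ℂ) * (τ : ℂ) + n) ^ k

/-- The Eisenstein series `H_k^{(a,b)}` of level `N`. For `k ≥ 3` the double series converges
absolutely (see `eisH_eq_tsum_prod`); for `k = 2` it is summed in Eisenstein's order, first over
`n`, then over `m`. -/
noncomputable def eisH (N : ℕ) (a b : ℤ) (k : ℕ) (τ : ℍ) : ℂ :=
  ∑' m : ℤ, ∑' n : ℤ, hTerm N a b k τ m n

theorem summable_hTerm (N : ℕ) (a b : ℤ) (k : ℕ) (hk : 3 ≤ k) (τ : ℍ) :
    Summable fun u : ℤ × ℤ => hTerm N a b k τ u.1 u.2 := by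
  have h := EisensteinSeries.summable_norm_eisSummand (k := (k : ℤ)) (by exact_mod_cast hk) τ
  rw [← (finTwoArrowEquiv ℤ).symm.summable_iff] at h
  refine Summable.of_norm_bounded h ?_
  rintro ⟨m, n⟩
  have hexp : ‖Complex.exp (2 * Real.pi * Complex.I * ((m * b - n * a : ℤ) : ℂ) / N)‖ = 1 := by
    have : (2 * Real.pi * Complex.I * ((m * b - n * a : ℤ) : ℂ) / N)
        = ((2 * Real.pi * ((m * b - n * a : ℤ) : ℝ) / N : ℝ) : ℂ) * Complex.I := by
      push_cast; ring
    rw [this, Complex.norm_exp_ofReal_mul_I]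
  unfold hTerm
  split_ifs with h0
  · simp
  · rw [norm_div, hexp]
    simp [EisensteinSeries.eisSummand]

theorem eisH_eq_tsum_prod (N : ℕ) (a b : ℤ) (k : ℕ) (hk : 3 ≤ k) (τ : ℍ) :
    eisH N a b k τ = ∑' u : ℤ × ℤ, hTerm N a b k τ u.1 u.2 :=
  ((summable_hTerm N a b k hk τ).tsum_prod).symm

/-- The integrand of `∫ from τ to i∞ of (f(z) - a₀) z ^ p dz`, along the vertical path
`z = τ + i t`, `t > 0`; here `a₀` is the constant Fourier coefficient of `f`, i.e. its limit
at `i∞`. -/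
noncomputable def tailIntegrand (f : ℍ → ℂ) (τ : ℍ) (p : ℕ) (t : ℝ) : ℂ :=
  (f (ofComplex ((τ : ℂ) + t * Complex.I)) - valueAtInfty f)
    * ((τ : ℂ) + t * Complex.I) ^ p * Complex.I

/-- The regularised integral of `f(z) z ^ p dz` from `τ` to the unit tangent vector at `i∞`:
`-a₀ τ ^ (p+1) / (p+1) + ∫ from τ to i∞ of (f(z) - a₀) z ^ p dz`. -/
noncomputable def regIntegral (f : ℍ → ℂ) (τ : ℍ) (p : ℕ) : ℂ :=
  -(valueAtInfty f * (τ : ℂ) ^ (p + 1) / (p + 1)) + ∫ t in Set.Ioi (0 : ℝ), tailIntegrand f τ p t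

/-- The regularised integral from `τ` to the unit tangent vector at `i∞` makes sense: `f` has a
limit at `i∞`, and the remaining integral converges absolutely. -/
def RegIntegralConverges (f : ℍ → ℂ) (τ : ℍ) (p : ℕ) : Prop :=
  Tendsto f atImInfty (𝓝 (valueAtInfty f)) ∧ IntegrableOn (tailIntegrand f τ p) (Set.Ioi 0)

/-- The completed `L`-function of `f` (of weight `k`) at the integer `l`, `1 ≤ l ≤ k - 1`: the
regularised integral of `f(τ) τ ^ (l-1) dτ` from the unit tangent vector at the cusp `0` to the
one at `i∞`. The path is cut at `i`. The part from the cusp `0` to `i` is brought to the cusp `i∞`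
by the substitution `τ = S σ = -1/σ`, which fixes `i` and turns `f(τ) τ ^ (l-1) dτ` into
`(-1) ^ (l-1) (f[S]_k)(σ) σ ^ (k-l-1) dσ`. -/
noncomputable def completedL (f : ℍ → ℂ) (k l : ℕ) : ℂ :=
  (-1) ^ l * regIntegral (f ∣[(k : ℤ)] ModularGroup.S) UpperHalfPlane.I (k - l - 1)
    + regIntegral f UpperHalfPlane.I (l - 1)

/-- Both regularised integrals that make up `completedL f k l` make sense. -/
def CompletedLConverges (f : ℍ → ℂ) (k l : ℕ) : Prop :=
  RegIntegralConverges (f ∣[(k : ℤ)] ModularGroup.S) UpperHalfPlane.I (k - l - 1)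
    ∧ RegIntegralConverges f UpperHalfPlane.I (l - 1)

/-- The polylogarithm series `∑_{n ≥ 1} z ^ n / n ^ m`, as the limit of its partial sums (on the
unit circle it converges only conditionally when `m = 1`). -/
noncomputable def polylog (m : ℕ) (z : ℂ) : ℂ :=
  ∑'[SummationFilter.conditional ℕ] n : ℕ, z ^ (n + 1) / ((n : ℂ) + 1) ^ m

/-- The Clausen function: real part of `Li_m(e ^ (ix))` for odd `m`, imaginary part for
even `m`. -/
noncomputable def clausen (m : ℕ) (x : ℝ) : ℝ :=
  if Odd m then (polylog m (Complex.exp (x * Complex.I))).re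
  else (polylog m (Complex.exp (x * Complex.I))).im

/-- The value `B_n(a / N)` of the Bernoulli polynomial. -/
noncomputable def bernoulliAt (n a N : ℕ) : ℂ :=
  (((Polynomial.bernoulli n).eval ((a : ℚ) / (N : ℚ)) : ℚ) : ℂ)

end EisensteinLValues

namespace EisensteinLValues

open HurwitzZeta

/-! Restricted to the imaginary axis, `H_k^{(a,b)}` and `H_k^{(b,-a)}` are exchanged by `y ↦ 1/y` up
to the factor `i^k y^k`, and each tends to its constant term exponentially fast. They therefore form
a `WeakFEPair`. Cutting its Mellin transform at `y = 1` gives the two regularised integrals based at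
`i`, so the completed `L`-value at `l` is `i^l Λ(l)` (`completedL_eisH_eq_Λ`).

For `Re s > k` the Fourier expansion, obtained from Lipschitz's formula, is integrated term by term.
The result is a Gamma factor times `expZeta B s * hurwitzZeta A (s-k+1)` plus `(-1)^k` times the
same product with `A, B` negated, where `A = a/N` and `B = b/N`. Both sides continue
meromorphically, so `Λ_eisPair` extends the identity to `s = l` unless `l = 1` and `B = 0`.

At `s = l` the Hurwitz factor is taken at a nonpositive integer, where it is a Bernoulli value with
parity in `A`. The two products then share this factor, and the functional equation of the Hurwitz
zeta function turns the remaining combination of `expZeta (±B) l` into a second Bernoulli value.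
Parity fails only for `a = 0`, `l = k-1`: both Hurwitz factors equal `ζ(0) = -1/2`, and what is left
is `E ± conj E` for a polylogarithm value `E`, which is a Clausen value. The case `b = 0`, `l = 1`,
where `expZeta` has a pole, follows from this one by the symmetry `completedL_eisH_symm`.

Two points need care. For `k = 2` the double series is not absolutely convergent, and the
interchange of sums behind the behaviour under `S` rests on cancellation of the character over `N ×
N` blocks (`summable_hTerm_blocks`). At `s = 1` the polylogarithm series converges only
conditionally, and summation by parts identifies its sum with `expZeta` (`tendsto_sum_expZeta_one`).
-/

/-! ### Additive characters modulo `N` -/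

/-- The additive character `x ↦ e ^ (2πix)`. -/
noncomputable def cis (x : ℂ) : ℂ := Complex.exp (2 * Real.pi * Complex.I * x)

theorem cis_add (x y : ℂ) : cis (x + y) = cis x * cis y := by
  rw [cis, mul_add, Complex.exp_add]; rfl

theorem cis_zero : cis 0 = 1 := by simp [cis]

theorem cis_intCast (n : ℤ) : cis n = 1 := by
  rw [cis, mul_comm]; exact Complex.exp_int_mul_two_pi_mul_I n

theorem cis_add_int (x : ℂ) (n : ℤ) : cis (x + n) = cis x := by
  rw [cis_add, cis_intCast, mul_one]

theorem cis_nat_mul (n : ℕ) (x : ℂ) : cis (n * x) = cis x ^ n := by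
  rw [cis, cis, ← Complex.exp_nat_mul]; ring_nf

theorem norm_cis (x : ℂ) : ‖cis x‖ = Real.exp (-2 * Real.pi * x.im) := by
  rw [cis, Complex.norm_exp]; simp

theorem norm_cis_ofReal (x : ℝ) : ‖cis x‖ = 1 := by
  rw [norm_cis]; simp

theorem norm_cis_int_div_nat (m : ℤ) (N : ℕ) : ‖cis (m / N)‖ = 1 := by
  have := norm_cis_ofReal ((m : ℝ) / N)
  push_cast at this
  exact this

theorem conj_cis_ofReal (x : ℝ) : (starRingEnd ℂ) (cis x) = cis (-x) := by
  rw [cis, cis, ← Complex.exp_conj]; simp [map_ofNat]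

theorem cis_neg_ofReal (x : ℝ) : cis ((-x : ℝ) : ℂ) = (starRingEnd ℂ) (cis x) := by
  rw [conj_cis_ofReal]; push_cast; rfl

theorem cis_eq_one_iff (x : ℂ) : cis x = 1 ↔ ∃ n : ℤ, x = n := by
  rw [cis, Complex.exp_eq_one_iff]
  refine exists_congr fun n ↦ ?_
  rw [mul_comm]
  exact mul_left_inj' Complex.two_pi_I_ne_zero

theorem cis_int_div_eq_one_iff {N : ℕ} (hN : N ≠ 0) (u : ℤ) : cis (u / N) = 1 ↔ (N : ℤ) ∣ u := by
  rw [cis_eq_one_iff]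
  have hN' : (N : ℂ) ≠ 0 := by exact_mod_cast hN
  constructor
  · rintro ⟨n, hn⟩
    rw [div_eq_iff hN'] at hn
    exact ⟨n, by rw [mul_comm]; exact_mod_cast hn⟩
  · rintro ⟨n, rfl⟩
    exact ⟨n, by push_cast; field_simp⟩

/-- Orthogonality of the additive characters modulo `N`. -/
theorem sum_cis {N : ℕ} (hN : N ≠ 0) (u : ℤ) :
    ∑ j ∈ Finset.range N, cis ((j * u : ℤ) / N) = if (N : ℤ) ∣ u then (N : ℂ) else 0 := by
  have hN' : (N : ℂ) ≠ 0 := by exact_mod_cast hN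
  have h1 (j : ℕ) : cis ((j * u : ℤ) / N) = cis (u / N) ^ j := by
    rw [← cis_nat_mul]; push_cast; ring_nf
  simp_rw [h1]
  split_ifs with h
  · simp [(cis_int_div_eq_one_iff hN u).2 h]
  · have h2 : cis (u / N) ≠ 1 := fun h' ↦ h ((cis_int_div_eq_one_iff hN u).1 h')
    rw [geom_sum_eq h2, ← cis_nat_mul, show (N : ℂ) * (u / N) = u by field_simp, cis_intCast]
    simp

/-! ### Lipschitz's formula with a character -/

/-- The constant in the twisted Lipschitz formula of level `N`. -/
noncomputable def lipschitzConst (N k : ℕ) : ℂ :=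
  (-2 * Real.pi * Complex.I) ^ k / (k - 1).factorial / N ^ (k - 1)

theorem summable_inv_add_int_pow {k : ℕ} (hk : 2 ≤ k) (z : ℂ) :
    Summable fun n : ℤ ↦ 1 / (z + n) ^ k := by
  have := EisensteinSeries.linear_right_summable z 1 (k := k) (by exact_mod_cast hk)
  simpa using this

theorem summable_pow_mul_cis (k : ℕ) (z : ℍ) :
    Summable fun r : ℕ ↦ (r : ℂ) ^ k * cis (r * z) := by
  have := summable_pow_mul_geometric_of_norm_lt_one k (r := cis z)
    (by
      have hpos : 0 < 2 * Real.pi * (z : ℂ).im :=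
        mul_pos (mul_pos two_pos Real.pi_pos) z.im_pos
      rw [norm_cis, Real.exp_lt_one_iff]
      linarith)
  simpa [cis_nat_mul] using this

/-- Lipschitz's formula, twisted by the character `n ↦ e ^ (-2πina/N)`. -/
theorem tsum_cis_div_pow {N : ℕ} (hN : N ≠ 0) {k : ℕ} (hk : 2 ≤ k) (a : ℤ) (α : ℕ) (hα : α < N)
    (haα : (N : ℤ) ∣ α - a) (z : ℍ) :
    ∑' n : ℤ, cis ((-(n * a) : ℤ) / N) / ((z : ℂ) + n) ^ k =
      lipschitzConst N k *
        ∑' t : ℕ, ((α + N * t : ℕ) : ℂ) ^ (k - 1) * cis ((α + N * t : ℕ) * (z / N)) := by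
  have hN' : (N : ℂ) ≠ 0 := by exact_mod_cast hN
  have : NeZero N := ⟨hN⟩
  have hNpos : (0 : ℝ) < N := by exact_mod_cast Nat.pos_of_ne_zero hN
  -- With `n = qN + j` one has `z + n = N (w j + q)`, and the character depends only on `j`. The
  -- untwisted formula applies at each `w j`, and summing over `j` selects the frequencies `r ≡ a`
  -- modulo `N` by orthogonality.
  let w (j : ℕ) : ℍ := ⟨(z + j) / N, by
    rw [Complex.div_natCast_im]; have := z.im_pos; simp; positivity⟩
  have hw (j : ℕ) : (w j : ℂ) = (z + j) / N := rfl
  have hsum : Summable fun n : ℤ ↦ cis ((-(n * a) : ℤ) / N) / ((z : ℂ) + n) ^ k := by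
    refine Summable.of_norm_bounded (summable_inv_add_int_pow hk z).norm fun n ↦ ?_
    rw [norm_div, norm_cis_int_div_nat, norm_div, norm_one]
  have hterm (q : ℤ) (j : Fin N) :
      cis ((-((q * N + (j : ℕ) : ℤ) * a) : ℤ) / N) / ((z : ℂ) + (q * N + (j : ℕ) : ℤ)) ^ k =
      cis ((-((j : ℕ) * a) : ℤ) / N) / N ^ k * (1 / ((w j : ℂ) + q) ^ k) := by
    have h1 : cis ((-((q * N + (j : ℕ) : ℤ) * a) : ℤ) / N) = cis ((-((j : ℕ) * a) : ℤ) / N) := by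
      rw [← cis_add_int _ (q * a)]
      congr 1; push_cast; field_simp; ring
    have h2 : ((z : ℂ) + (q * N + (j : ℕ) : ℤ)) = N * ((w j : ℂ) + q) := by
      rw [hw]; push_cast; field_simp; ring
    rw [h1, h2, mul_pow]; field_simp
  have hexp (r j : ℕ) : cis (r * w j) = cis (r * (z / N)) * cis ((j * r : ℤ) / N) := by
    rw [← cis_add, hw]; congr 1; push_cast; field_simp
  set c : ℂ := (-2 * Real.pi * Complex.I) ^ k / (k - 1).factorial
  have hlip (j : ℕ) : ∑' q : ℤ, 1 / ((w j : ℂ) + q) ^ k =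
      c * ∑' r : ℕ, (r : ℂ) ^ (k - 1) * cis (r * w j) := by
    have := EisensteinSeries.qExpansion_identity (k := k - 1) (by omega) (w j)
    rw [show k - 1 + 1 = k by omega] at this
    rw [this]
    congr 1
    refine tsum_congr fun r ↦ ?_
    rw [cis_nat_mul, cis]
  rw [← (Int.divModEquiv N).symm.tsum_eq]
  have hsum' := (Int.divModEquiv N).symm.summable_iff.2 hsum
  rw [← (Equiv.prodComm _ _).tsum_eq]
  refine (Summable.tsum_prod ((Equiv.prodComm _ _).summable_iff.2 hsum')).trans ?_
  rw [tsum_fintype]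
  have hinner (j : Fin N) : ∑' q : ℤ, cis ((-((q * N + (j : ℕ) : ℤ) * a) : ℤ) / N) /
        ((z : ℂ) + (q * N + (j : ℕ) : ℤ)) ^ k =
      c / N ^ k * ∑' r : ℕ, (r : ℂ) ^ (k - 1) * cis (r * (z / N)) *
        cis (((j : ℕ) * (r - a) : ℤ) / N) := by
    simp_rw [hterm, tsum_mul_left, hlip]
    rw [← tsum_mul_left, ← tsum_mul_left, ← tsum_mul_left]
    refine tsum_congr fun r ↦ ?_
    have h3 : cis (((j : ℕ) * (r - a) : ℤ) / N) =
        cis ((-((j : ℕ) * a) : ℤ) / N) * cis (((j : ℕ) * r : ℤ) / N) := by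
      rw [← cis_add]; congr 1; push_cast; ring
    rw [hexp, h3]
    ring
  have hsummable (j : ℕ) : Summable fun r : ℕ ↦ (r : ℂ) ^ (k - 1) * cis (r * (z / N)) *
        cis ((j * (r - a) : ℤ) / N) := by
    refine Summable.of_norm_bounded (summable_pow_mul_cis (k - 1) (w 0)).norm fun r ↦ ?_
    rw [norm_mul _ (cis ((j * (r - a) : ℤ) / N)), norm_cis_int_div_nat, hw]
    simp
  calc _ = ∑ j : Fin N, c / N ^ k * ∑' r : ℕ, (r : ℂ) ^ (k - 1) * cis (r * (z / N)) *
        cis (((j : ℕ) * (r - a) : ℤ) / N) := Finset.sum_congr rfl fun j _ ↦ hinner j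
    _ = c / N ^ k * ∑' r : ℕ, (r : ℂ) ^ (k - 1) * cis (r * (z / N)) *
        (if (N : ℤ) ∣ r - a then (N : ℂ) else 0) := by
      rw [Fin.sum_univ_eq_sum_range (fun j : ℕ ↦ c / N ^ k * ∑' r : ℕ, (r : ℂ) ^ (k - 1) *
        cis (r * (z / N)) * cis ((j * (r - a) : ℤ) / N)) N, ← Finset.mul_sum,
        ← Summable.tsum_finsetSum fun j _ ↦ hsummable j]
      simp_rw [← Finset.mul_sum, sum_cis hN]
    _ = _ := by
      have hinj : Function.Injective fun t : ℕ ↦ α + N * t := fun t t' h ↦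
        Nat.eq_of_mul_eq_mul_left (Nat.pos_of_ne_zero hN) (Nat.add_left_cancel h)
      rw [← hinj.tsum_eq]
      · rw [show lipschitzConst N k = c / N ^ (k - 1) from rfl, ← tsum_mul_left, ← tsum_mul_left]
        refine tsum_congr fun t ↦ ?_
        rw [if_pos]
        · have : (N : ℂ) ^ k = N ^ (k - 1) * N := by rw [← pow_succ]; congr 1; omega
          rw [this]; field_simp
        · obtain ⟨d, hd⟩ := haα
          exact ⟨d + t, by push_cast; linarith⟩
      · intro r hr
        have hdvd : (N : ℤ) ∣ r - a := by
          by_contra h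
          simp [h] at hr
        have h1 : (N : ℤ) ∣ (r : ℤ) - α := by
          have := dvd_sub hdvd haα
          simpa using this
        have h2 : α % N = r % N := (Nat.modEq_iff_dvd).2 h1
        rw [Nat.mod_eq_of_lt hα] at h2
        exact ⟨r / N, by simp only [h2]; exact Nat.mod_add_div r N⟩

/-! ### The Fourier expansion -/

/-- The terms of the Fourier expansion of the Eisenstein series, where the pair `p = (m, t)`
stands for the positive integer `m + 1` and the integer `α + N t` in the class of `α`. -/
noncomputable def qTerm (N α : ℕ) (β : ℤ) (k : ℕ) (τ : ℂ) (p : ℕ × ℕ) : ℂ :=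
  cis (((p.1 + 1) * β : ℤ) / N) * ((α + N * p.2 : ℕ) : ℂ) ^ (k - 1) *
    cis (((p.1 + 1) * (α + N * p.2) : ℕ) * (τ / N))

/-- The absolute value of `qTerm` as a function of the imaginary part. -/
noncomputable def qMajorant (N α k : ℕ) (y : ℝ) (p : ℕ × ℕ) : ℝ :=
  ((α + N * p.2 : ℕ) : ℝ) ^ (k - 1) *
    Real.exp (-(2 * Real.pi * (((p.1 + 1) * (α + N * p.2) : ℕ) * (y / N))))

/-- The Fourier series formed from one residue class of exponents. -/
noncomputable def qSer (N α : ℕ) (β : ℤ) (k : ℕ) (τ : ℂ) : ℂ := ∑' p, qTerm N α β k τ p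

theorem norm_qTerm (N α : ℕ) (β : ℤ) (k : ℕ) (τ : ℂ) (p : ℕ × ℕ) :
    ‖qTerm N α β k τ p‖ = qMajorant N α k τ.im p := by
  rw [qTerm, norm_mul, norm_mul, norm_cis_int_div_nat, norm_pow, Complex.norm_natCast, norm_cis,
    qMajorant, one_mul, ← nsmul_eq_mul, Complex.smul_im, nsmul_eq_mul,
    Complex.div_natCast_im, neg_mul, neg_mul]

theorem qMajorant_nonneg (N α k : ℕ) (y : ℝ) (p : ℕ × ℕ) : 0 ≤ qMajorant N α k y p := by
  unfold qMajorant; positivity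

/-- A term whose exponent `(m+1)(α+Nt)` is nonzero has exponent at least `1`, so a decay factor
independent of `p` can be taken out. Terms with exponent zero vanish because `k - 1 ≥ 1`. -/
theorem qMajorant_le {N α k : ℕ} (hk : 2 ≤ k) {y₀ y : ℝ} (hy : y₀ ≤ y) (p : ℕ × ℕ) :
    qMajorant N α k y p ≤ Real.exp (-(2 * Real.pi * ((y - y₀) / N))) * qMajorant N α k y₀ p := by
  rcases Nat.eq_zero_or_pos (α + N * p.2) with h | h
  · simp [qMajorant, h, show k - 1 ≠ 0 by omega]
  · rw [qMajorant, qMajorant, mul_left_comm (Real.exp _), ← Real.exp_add]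
    gcongr
    have h1 : (1 : ℝ) ≤ ((p.1 + 1) * (α + N * p.2) : ℕ) := by
      exact_mod_cast Nat.mul_pos (Nat.succ_pos _) h
    have h2 : 0 ≤ (y - y₀) / N := div_nonneg (sub_nonneg.2 hy) (Nat.cast_nonneg _)
    have h3 := mul_le_mul_of_nonneg_right h1 h2
    have h4 : (y : ℝ) / N = (y - y₀) / N + y₀ / N := by ring
    rw [h4]
    nlinarith [Real.pi_pos]

theorem qMajorant_antitone {N α k : ℕ} (hk : 2 ≤ k) {y₀ y : ℝ} (hy : y₀ ≤ y) (p : ℕ × ℕ) :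
    qMajorant N α k y p ≤ qMajorant N α k y₀ p := by
  refine (qMajorant_le hk hy p).trans (mul_le_of_le_one_left (qMajorant_nonneg ..) ?_)
  rw [Real.exp_le_one_iff, neg_nonpos]
  have h2 : 0 ≤ (y - y₀) / N := div_nonneg (sub_nonneg.2 hy) (Nat.cast_nonneg _)
  have := Real.pi_pos
  positivity

theorem add_mul_injective {N : ℕ} (hN : N ≠ 0) (α : ℕ) :
    Function.Injective fun t : ℕ ↦ α + N * t := fun _ _ h ↦
  Nat.eq_of_mul_eq_mul_left (Nat.pos_of_ne_zero hN) (Nat.add_left_cancel h)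

theorem summable_qMajorant {N : ℕ} (hN : N ≠ 0) (α : ℕ) {k : ℕ} (hk : 2 ≤ k) {y : ℝ}
    (hy : 0 < y) : Summable (qMajorant N α k y) := by
  have hN' : (0 : ℝ) < N := by exact_mod_cast Nat.pos_of_ne_zero hN
  set ρ : ℝ := Real.exp (-(2 * Real.pi * (y / N))) with hρ
  have hρ0 : 0 < ρ := Real.exp_pos _
  have hρ1 : ρ < 1 := by
    rw [hρ, Real.exp_lt_one_iff, neg_lt_zero]
    have := Real.pi_pos
    positivity
  have h1 : Summable fun r : ℕ ↦ (r : ℝ) ^ (k - 1) * ρ ^ r :=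
    summable_pow_mul_geometric_of_norm_lt_one _ (by rwa [Real.norm_of_nonneg hρ0.le])
  have h2 := (summable_geometric_of_lt_one hρ0.le hρ1).mul_of_nonneg
    (h1.comp_injective (add_mul_injective hN α)) (fun n ↦ pow_nonneg hρ0.le n)
    (fun n ↦ by simp only [Function.comp_apply, Pi.zero_apply]; positivity)
  refine Summable.of_nonneg_of_le (qMajorant_nonneg N α k y) (fun p ↦ ?_) h2
  simp only [qMajorant, Function.comp_apply]
  rcases Nat.eq_zero_or_pos (α + N * p.2) with h | h
  · simp [h, show k - 1 ≠ 0 by omega]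
  · rw [mul_left_comm (ρ ^ _), ← pow_add]
    gcongr
    rw [hρ, ← Real.exp_nat_mul, mul_neg]
    refine Real.exp_le_exp.2 (neg_le_neg ?_)
    rw [mul_left_comm]
    -- For `r ≥ 1`, `(m+1) r ≥ m + r`, so the double series is dominated by a product of two
    -- convergent single series.
    have h3 : p.1 + (α + N * p.2) ≤ (p.1 + 1) * (α + N * p.2) := by nlinarith
    have := Real.pi_pos
    gcongr

theorem summable_qTerm {N : ℕ} (hN : N ≠ 0) (α : ℕ) (β : ℤ) {k : ℕ} (hk : 2 ≤ k) {τ : ℂ}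
    (hτ : 0 < τ.im) : Summable (qTerm N α β k τ) :=
  Summable.of_norm (by simpa only [norm_qTerm] using summable_qMajorant hN α hk hτ)

theorem norm_qSer_le {N : ℕ} (hN : N ≠ 0) (α : ℕ) (β : ℤ) {k : ℕ} (hk : 2 ≤ k) {τ : ℂ}
    (hτ : 1 ≤ τ.im) : ‖qSer N α β k τ‖ ≤
      Real.exp (-(2 * Real.pi * ((τ.im - 1) / N))) * ∑' p, qMajorant N α k 1 p := by
  have hs := summable_qMajorant hN α hk (one_pos)
  rw [← tsum_mul_left]
  refine tsum_of_norm_bounded (hs.mul_left _).hasSum fun p ↦ ?_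
  rw [norm_qTerm]
  exact qMajorant_le hk hτ p

theorem continuousOn_qSer {N : ℕ} (hN : N ≠ 0) (α : ℕ) (β : ℤ) {k : ℕ} (hk : 2 ≤ k) :
    ContinuousOn (qSer N α β k) {τ : ℂ | 0 < τ.im} := by
  intro τ hτ
  have hτ' : 0 < τ.im / 2 := half_pos hτ
  have h : ContinuousOn (qSer N α β k) {z : ℂ | τ.im / 2 ≤ z.im} := by
    refine continuousOn_tsum (fun p ↦ ?_) (summable_qMajorant hN α hk hτ') fun p z hz ↦ ?_
    · unfold qTerm cis; fun_prop
    · rw [norm_qTerm]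
      exact qMajorant_antitone hk hz p
  refine (h.continuousAt ?_).continuousWithinAt
  have : {z : ℂ | τ.im / 2 < z.im} ∈ 𝓝 τ :=
    (isOpen_lt continuous_const Complex.continuous_im).mem_nhds (half_lt_self (a := τ.im) hτ)
  exact mem_of_superset this fun z hz ↦ (show τ.im / 2 < z.im from hz).le

/-- The case distinction can be dropped: at `(0,0)` the denominator is `0 ^ k = 0`, and division by
zero gives `0`. -/
theorem hTerm_eq {N : ℕ} {a b : ℤ} {k : ℕ} (hk : k ≠ 0) (τ : ℍ) (m n : ℤ) :
    hTerm N a b k τ m n =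
      cis ((m * b : ℤ) / N) * (cis ((-(n * a) : ℤ) / N) / ((m : ℂ) * τ + n) ^ k) := by
  unfold hTerm
  split_ifs with h
  · simp [h.1, h.2, hk]
  · rw [← mul_div_assoc, ← cis_add, cis]
    congr 2
    push_cast; ring

/-- The constant term of the Eisenstein series. -/
noncomputable def eisConst (N : ℕ) (a : ℤ) (k : ℕ) : ℂ :=
  ∑' n : ℤ, cis ((-(n * a) : ℤ) / N) / (n : ℂ) ^ k

theorem tsum_hTerm_pos {N : ℕ} (hN : N ≠ 0) (a b : ℤ) {k : ℕ} (hk : 2 ≤ k) {α : ℕ} (hα : α < N)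
    (haα : (N : ℤ) ∣ α - a) (τ : ℍ) (m : ℕ) :
    ∑' n : ℤ, hTerm N a b k τ (m + 1) n =
      lipschitzConst N k * ∑' t : ℕ, qTerm N α b k τ (m, t) := by
  let w : ℍ := ⟨(m + 1) * τ, by
    have := τ.im_pos; simp; positivity⟩
  have hw : (w : ℂ) = (m + 1) * τ := rfl
  have h := tsum_cis_div_pow hN hk a α hα haα w
  simp_rw [hTerm_eq (show k ≠ 0 by omega)]
  push_cast at h ⊢
  rw [tsum_mul_left, ← hw, h, mul_left_comm, ← tsum_mul_left]
  congr 1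
  refine tsum_congr fun t ↦ ?_
  rw [qTerm, hw]
  push_cast
  ring_nf

/-- Changing the sign of both summation indices brings the row back to a positive one for the pair
`(-a,-b)`, at the cost of `(-1)^k`. -/
theorem tsum_hTerm_neg {N : ℕ} (hN : N ≠ 0) (a b : ℤ) {k : ℕ} (hk : 2 ≤ k) {α : ℕ} (hα : α < N)
    (haα : (N : ℤ) ∣ α + a) (τ : ℍ) (m : ℕ) :
    ∑' n : ℤ, hTerm N a b k τ (-(m + 1)) n =
      (-1) ^ k * (lipschitzConst N k * ∑' t : ℕ, qTerm N α (-b) k τ (m, t)) := by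
  rw [← tsum_hTerm_pos hN (-a) (-b) hk hα (by simpa using haα), ← tsum_mul_left,
    ← (Equiv.neg ℤ).tsum_eq]
  refine tsum_congr fun n ↦ ?_
  rw [hTerm_eq (by omega), hTerm_eq (by omega)]
  have h1 : (((-(m + 1 : ℤ) : ℤ) : ℂ) * τ + ((Equiv.neg ℤ) n : ℤ)) ^ k =
      (-1) ^ k * (((m + 1 : ℤ) : ℂ) * τ + n) ^ k := by
    rw [← mul_pow]; congr 1; simp; ring
  have h2 : ((-1 : ℂ) ^ k)⁻¹ = (-1) ^ k := by rw [← inv_pow]; norm_num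
  rw [h1, div_mul_eq_div_div, div_eq_mul_inv _ ((-1 : ℂ) ^ k), h2]
  simp
  ring_nf

/-- The Fourier expansion of the Eisenstein series, with convergence of the sum over `m`. -/
theorem hasSum_eisH {N : ℕ} (hN : N ≠ 0) (a b : ℤ) {k : ℕ} (hk : 2 ≤ k) {α α' : ℕ} (hα : α < N)
    (haα : (N : ℤ) ∣ α - a) (hα' : α' < N) (haα' : (N : ℤ) ∣ α' + a) (τ : ℍ) :
    HasSum (fun m : ℤ ↦ ∑' n : ℤ, hTerm N a b k τ m n)
      (eisConst N a k + lipschitzConst N k *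
        (qSer N α b k τ + (-1) ^ k * qSer N α' (-b) k τ)) := by
  have hq (γ : ℕ) (c : ℤ) : HasSum (fun m : ℕ ↦ ∑' t : ℕ, qTerm N γ c k τ (m, t))
      (qSer N γ c k τ) := by
    have h : Summable (qTerm N γ c k τ) := summable_qTerm hN γ c hk τ.im_pos
    exact h.hasSum.prod_fiberwise fun m ↦ (h.prod_factor m).hasSum
  have h1 : HasSum (fun m : ℕ ↦ ∑' n : ℤ, hTerm N a b k τ (m + 1) n)
      (lipschitzConst N k * qSer N α b k τ) := by
    rw [funext fun m : ℕ ↦ tsum_hTerm_pos hN a b hk hα haα τ m]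
    exact (hq α b).mul_left _
  have h2 : HasSum (fun m : ℕ ↦ ∑' n : ℤ, hTerm N a b k τ (-(m + 1)) n)
      ((-1) ^ k * (lipschitzConst N k * qSer N α' (-b) k τ)) := by
    rw [funext fun m : ℕ ↦ tsum_hTerm_neg hN a b hk hα' haα' τ m]
    exact ((hq α' (-b)).mul_left _).mul_left _
  have h0 : ∑' n : ℤ, hTerm N a b k τ 0 n = eisConst N a k := by
    refine tsum_congr fun n ↦ ?_
    rw [hTerm_eq (by omega)]
    simp [cis_zero]
  have h3 := HasSum.of_add_one_of_neg_add_one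
    (f := fun m : ℤ ↦ ∑' n : ℤ, hTerm N a b k τ m n) h1 h2
  simp only [h0] at h3
  rwa [show eisConst N a k + lipschitzConst N k * (qSer N α b k τ +
    (-1) ^ k * qSer N α' (-b) k τ) = lipschitzConst N k * qSer N α b k τ + eisConst N a k +
    (-1) ^ k * (lipschitzConst N k * qSer N α' (-b) k τ) by ring]

theorem eisH_eq {N : ℕ} (hN : N ≠ 0) (a b : ℤ) {k : ℕ} (hk : 2 ≤ k) {α α' : ℕ} (hα : α < N)
    (haα : (N : ℤ) ∣ α - a) (hα' : α' < N) (haα' : (N : ℤ) ∣ α' + a) (τ : ℍ) :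
    eisH N a b k τ = eisConst N a k + lipschitzConst N k *
        (qSer N α b k τ + (-1) ^ k * qSer N α' (-b) k τ) :=
  (hasSum_eisH hN a b hk hα haα hα' haα' τ).tsum_eq

theorem exists_residue {N : ℕ} (hN : N ≠ 0) (a : ℤ) : ∃ α < N, (N : ℤ) ∣ (α : ℤ) - a := by
  have hN' : (N : ℤ) ≠ 0 := by exact_mod_cast hN
  refine ⟨(a % N).toNat, ?_, ?_⟩
  · have := Int.emod_lt_of_pos a (show (0 : ℤ) < N by omega)
    have := Int.emod_nonneg a hN'
    omega
  · rw [Int.toNat_of_nonneg (Int.emod_nonneg a hN')]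
    exact ⟨-(a / N), by linarith [Int.emod_add_mul_ediv a N]⟩

theorem exists_residue_neg {N : ℕ} (hN : N ≠ 0) (a : ℤ) : ∃ α < N, (N : ℤ) ∣ (α : ℤ) + a := by
  simpa using exists_residue hN (-a)

theorem summable_tsum_hTerm {N : ℕ} (hN : N ≠ 0) (a b : ℤ) {k : ℕ} (hk : 2 ≤ k) (τ : ℍ) :
    Summable fun m : ℤ ↦ ∑' n : ℤ, hTerm N a b k τ m n := by
  obtain ⟨α, hα, haα⟩ := exists_residue hN a
  obtain ⟨α', hα', haα'⟩ := exists_residue_neg hN a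
  exact (hasSum_eisH hN a b hk hα haα hα' haα' τ).summable

/-! ### Behaviour at the cusp and continuity -/

/-- The Eisenstein series tends to its constant term exponentially fast at `i∞`. -/
theorem exists_norm_eisH_sub_le {N : ℕ} (hN : N ≠ 0) (a b : ℤ) {k : ℕ} (hk : 2 ≤ k) :
    ∃ D : ℝ, ∀ τ : ℍ, 1 ≤ τ.im →
      ‖eisH N a b k τ - eisConst N a k‖ ≤ D * Real.exp (-(2 * Real.pi / N) * τ.im) := by
  obtain ⟨α, hα, haα⟩ := exists_residue hN a
  obtain ⟨α', hα', haα'⟩ := exists_residue_neg hN a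
  refine ⟨‖lipschitzConst N k‖ * (∑' p, qMajorant N α k 1 p + ∑' p, qMajorant N α' k 1 p) *
    Real.exp (2 * Real.pi / N), fun τ hτ ↦ ?_⟩
  have hexp : Real.exp (-(2 * Real.pi * ((τ.im - 1) / N))) =
      Real.exp (2 * Real.pi / N) * Real.exp (-(2 * Real.pi / N) * τ.im) := by
    rw [← Real.exp_add]; ring_nf
  have h1 := norm_qSer_le hN α b hk (τ := τ) hτ
  have h2 := norm_qSer_le hN α' (-b) hk (τ := τ) hτ
  rw [coe_im, hexp] at h1 h2
  rw [eisH_eq hN a b hk hα haα hα' haα' τ, add_sub_cancel_left, norm_mul, mul_assoc, mul_assoc]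
  gcongr
  refine (norm_add_le _ _).trans ?_
  rw [norm_mul, norm_pow, norm_neg, norm_one, one_pow, one_mul]
  linarith

theorem tendsto_eisH {N : ℕ} (hN : N ≠ 0) (a b : ℤ) {k : ℕ} (hk : 2 ≤ k) :
    Tendsto (eisH N a b k) atImInfty (𝓝 (eisConst N a k)) := by
  obtain ⟨D, hD⟩ := exists_norm_eisH_sub_le hN a b hk
  have hN' : (0 : ℝ) < N := by exact_mod_cast Nat.pos_of_ne_zero hN
  have hc : 0 < 2 * Real.pi / N := by have := Real.pi_pos; positivity
  rw [tendsto_iff_norm_sub_tendsto_zero]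
  have h1 : Tendsto (fun y : ℝ ↦ D * Real.exp (-(2 * Real.pi / N) * y)) atTop (𝓝 0) := by
    rw [← mul_zero D]
    refine (Real.tendsto_exp_atBot.comp ?_).const_mul D
    exact (tendsto_id.const_mul_atTop_of_neg (neg_lt_zero.2 hc))
  have h2 : Tendsto UpperHalfPlane.im atImInfty atTop := tendsto_comap
  refine squeeze_zero' (Eventually.of_forall fun _ ↦ norm_nonneg _) ?_ (h1.comp h2)
  filter_upwards [h2.eventually_ge_atTop 1] with τ hτ using hD τ hτ

theorem valueAtInfty_eisH {N : ℕ} (hN : N ≠ 0) (a b : ℤ) {k : ℕ} (hk : 2 ≤ k) :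
    valueAtInfty (eisH N a b k) = eisConst N a k :=
  haveI : (atImInfty).NeBot := inferInstance
  (tendsto_eisH hN a b hk).limUnder_eq

theorem continuousOn_eisH {N : ℕ} (hN : N ≠ 0) (a b : ℤ) {k : ℕ} (hk : 2 ≤ k) :
    ContinuousOn (fun τ : ℂ ↦ eisH N a b k (ofComplex τ)) {τ : ℂ | 0 < τ.im} := by
  obtain ⟨α, hα, haα⟩ := exists_residue hN a
  obtain ⟨α', hα', haα'⟩ := exists_residue_neg hN a
  have h := (continuousOn_const (c := eisConst N a k)).add
    ((continuousOn_const (c := lipschitzConst N k)).mul ((continuousOn_qSer hN α b hk).add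
      ((continuousOn_const (c := (-1 : ℂ) ^ k)).mul (continuousOn_qSer hN α' (-b) hk))))
  refine h.congr fun τ hτ ↦ ?_
  simp only [eisH_eq hN a b hk hα haα hα' haα', ofComplex_apply_of_im_pos hτ]
  rfl

/-! ### Interchange of summation and the transformation under `S` -/

section Rearrangement

theorem hasSum_int_blocks {N : ℕ} (hN : N ≠ 0) {f : ℤ → ℂ} (hf : Summable f) :
    HasSum (fun q : ℤ ↦ ∑ d ∈ Finset.range N, f (q * N + d)) (∑' n, f n) := by
  have : NeZero N := ⟨hN⟩
  have h := ((Int.divModEquiv N).symm.hasSum_iff.2 hf.hasSum).prod_fiberwise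
    fun q ↦ hasSum_fintype _
  convert h using 2 with q
  exact (Fin.sum_univ_eq_sum_range (fun d ↦ f (q * N + d)) N).symm

theorem tsum_tsum_eq_blocks {N : ℕ} (hN : N ≠ 0) {G : ℤ → ℤ → ℂ} (hrow : ∀ m, Summable (G m))
    (hR : Summable fun m ↦ ∑' n, G m n) :
    ∑' m, ∑' n, G m n = ∑' p : ℤ, ∑' q : ℤ,
      ∑ c ∈ Finset.range N, ∑ d ∈ Finset.range N, G (p * N + c) (q * N + d) := by
  rw [← (hasSum_int_blocks hN hR).tsum_eq]
  refine tsum_congr fun p ↦ ?_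
  refine Eq.trans ?_ (Summable.tsum_finsetSum (s := Finset.range N) fun c _ ↦
    (hasSum_int_blocks hN (hrow (p * N + c))).summable).symm
  exact Finset.sum_congr rfl fun c _ ↦ (hasSum_int_blocks hN (hrow (p * N + c))).tsum_eq.symm

/-- The order of summation in a double series may be changed if the series converges absolutely
after grouping it into square blocks. -/
theorem tsum_tsum_comm_of_blocks {N : ℕ} (hN : N ≠ 0) {G : ℤ → ℤ → ℂ}
    (hrow : ∀ m, Summable (G m)) (hcol : ∀ n, Summable fun m ↦ G m n)
    (hR : Summable fun m ↦ ∑' n, G m n) (hC : Summable fun n ↦ ∑' m, G m n)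
    (hB : Summable fun u : ℤ × ℤ ↦
      ∑ c ∈ Finset.range N, ∑ d ∈ Finset.range N, G (u.1 * N + c) (u.2 * N + d)) :
    ∑' n, ∑' m, G m n = ∑' m, ∑' n, G m n := by
  rw [tsum_tsum_eq_blocks hN hrow hR, tsum_tsum_eq_blocks (G := fun n m ↦ G m n) hN hcol hC]
  refine Eq.trans ?_ (Summable.tsum_comm hB)
  exact tsum_congr fun p ↦ tsum_congr fun q ↦ Finset.sum_comm

end Rearrangement

theorem mul_sq_le_cube_add {x y : ℝ} (hx : 0 ≤ x) (hy : 0 ≤ y) : x * y ^ 2 ≤ x ^ 3 + y ^ 3 := by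
  rcases le_total x y with h | h
  · nlinarith [pow_nonneg hx 3, mul_le_mul_of_nonneg_right h (sq_nonneg y)]
  · have := mul_le_mul_of_nonneg_left (pow_le_pow_left₀ hy h 2) hx
    nlinarith [pow_nonneg hy 3]

/-- The difference is a multiple of `u - w` by products of total degree three in `1/u` and `1/w`.
The convention `1/0 = 0` is covered too, so lattice points at the origin need no separate treatment
later. -/
theorem norm_inv_sq_sub_inv_sq_le (u w : ℂ) :
    ‖1 / u ^ 2 - 1 / w ^ 2‖ ≤ 2 * ‖u - w‖ * (1 / ‖u‖ ^ 3 + 1 / ‖w‖ ^ 3) := by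
  have key (w : ℂ) : 1 / ‖w‖ ^ 2 ≤ 2 * ‖w‖ * (1 / ‖w‖ ^ 3) := by
    rcases eq_or_ne w 0 with rfl | hw
    · simp
    · have := norm_pos_iff.2 hw
      rw [show 2 * ‖w‖ * (1 / ‖w‖ ^ 3) = 2 * (1 / ‖w‖ ^ 2) by field_simp]
      have : 0 < 1 / ‖w‖ ^ 2 := by positivity
      linarith
  rcases eq_or_ne u 0 with rfl | hu
  · simpa using key w
  rcases eq_or_ne w 0 with rfl | hw
  · simpa using key u
  have hu' := norm_pos_iff.2 hu
  have hw' := norm_pos_iff.2 hw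
  have h1 : 1 / u ^ 2 - 1 / w ^ 2 = -(u - w) * (1 / u * (1 / w) ^ 2 + 1 / w * (1 / u) ^ 2) := by
    field_simp; ring
  rw [h1, norm_mul, norm_neg, mul_comm 2, mul_assoc]
  refine mul_le_mul_of_nonneg_left ?_ (norm_nonneg _)
  refine (norm_add_le _ _).trans ?_
  simp only [norm_mul, norm_pow, norm_div, norm_one]
  have h2 := mul_sq_le_cube_add (x := 1 / ‖u‖) (y := 1 / ‖w‖) (by positivity) (by positivity)
  have h3 := mul_sq_le_cube_add (x := 1 / ‖w‖) (y := 1 / ‖u‖) (by positivity) (by positivity)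
  simp only [one_div, inv_pow] at h2 h3 ⊢
  linarith

theorem sum_sum_cis_eq_zero {N : ℕ} (hN : N ≠ 0) {a b : ℤ} (h : ¬ ((N : ℤ) ∣ a ∧ (N : ℤ) ∣ b)) :
    ∑ c ∈ Finset.range N, ∑ d ∈ Finset.range N, cis ((c * b - d * a : ℤ) / N) = 0 := by
  have h1 (c d : ℕ) : cis ((c * b - d * a : ℤ) / N) =
      cis ((c * b : ℤ) / N) * cis ((d * (-a) : ℤ) / N) := by
    rw [← cis_add]; congr 1; push_cast; ring
  simp_rw [h1, ← Finset.mul_sum, ← Finset.sum_mul]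
  rw [sum_cis hN, sum_cis hN]
  by_cases ha : (N : ℤ) ∣ a
  · rw [if_neg fun hb ↦ h ⟨ha, hb⟩, zero_mul]
  · rw [if_neg (mt dvd_neg.1 ha), mul_zero]

/-- The indices form an injective image inside the lattice, so this is a subseries of the absolutely
convergent weight 3 series. -/
theorem summable_inv_norm_cube {N : ℕ} (hN : N ≠ 0) (τ : ℍ) (c d : ℕ) :
    Summable fun u : ℤ × ℤ ↦
      1 / ‖((u.1 * N + c : ℤ) : ℂ) * τ + (u.2 * N + d : ℤ)‖ ^ 3 := by
  have hN' : (N : ℤ) ≠ 0 := by exact_mod_cast hN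
  have h := (summable_hTerm 1 0 0 3 le_rfl τ).norm
  have hinj : Function.Injective fun u : ℤ × ℤ ↦ ((u.1 * N + c, u.2 * N + d) : ℤ × ℤ) := by
    intro u v huv
    simp only [Prod.mk.injEq, add_left_inj, mul_eq_mul_right_iff, hN', or_false] at huv
    exact Prod.ext huv.1 huv.2
  refine (h.comp_injective hinj).congr fun u ↦ ?_
  simp only [Function.comp_apply]
  rw [hTerm_eq (by omega)]
  simp [cis_zero]

/-- The character sums to zero over a block, so one reference value of `1/(mτ+n)^2` may be
subtracted from every term of the block. The differences have order `|mτ+n|^(-3)`, which is summable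
over the lattice. -/
theorem summable_hTerm_blocks {N : ℕ} (hN : N ≠ 0) {a b : ℤ} (h : ¬ ((N : ℤ) ∣ a ∧ (N : ℤ) ∣ b))
    (τ : ℍ) : Summable fun u : ℤ × ℤ ↦ ∑ c ∈ Finset.range N, ∑ d ∈ Finset.range N,
      hTerm N a b 2 τ (u.1 * N + c) (u.2 * N + d) := by
  have hN' : (N : ℂ) ≠ 0 := by exact_mod_cast hN
  have hterm (u : ℤ × ℤ) (c d : ℕ) : hTerm N a b 2 τ (u.1 * N + c) (u.2 * N + d) =
      cis ((c * b - d * a : ℤ) / N) *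
        (1 / (((u.1 * N + c : ℤ) : ℂ) * τ + (u.2 * N + d : ℤ)) ^ 2) := by
    rw [hTerm_eq two_ne_zero, ← mul_div_assoc, ← cis_add, mul_one_div,
      ← cis_add_int ((c * b - d * a : ℤ) / N) (u.1 * b - u.2 * a)]
    congr 2
    push_cast; field_simp; ring
  have hblock (u : ℤ × ℤ) : ∑ c ∈ Finset.range N, ∑ d ∈ Finset.range N,
      hTerm N a b 2 τ (u.1 * N + c) (u.2 * N + d) =
      ∑ c ∈ Finset.range N, ∑ d ∈ Finset.range N, cis ((c * b - d * a : ℤ) / N) *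
        (1 / (((u.1 * N + c : ℤ) : ℂ) * τ + (u.2 * N + d : ℤ)) ^ 2 -
         1 / (((u.1 * N + (0 : ℕ) : ℤ) : ℂ) * τ + (u.2 * N + (0 : ℕ) : ℤ)) ^ 2) := by
    simp_rw [mul_sub, Finset.sum_sub_distrib, ← Finset.sum_mul, sum_sum_cis_eq_zero hN h, hterm]
    simp
  simp_rw [hblock]
  refine summable_sum fun c _ ↦ summable_sum fun d _ ↦ ?_
  refine Summable.of_norm_bounded (((summable_inv_norm_cube hN τ c d).add
    (summable_inv_norm_cube hN τ 0 0)).mul_left (2 * ‖(c * τ + d : ℂ)‖)) fun u ↦ ?_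
  rw [norm_mul, norm_cis_int_div_nat, one_mul]
  refine (norm_inv_sq_sub_inv_sq_le _ _).trans (le_of_eq ?_)
  congr 3
  push_cast; ring

theorem summable_hTerm_row {N : ℕ} {a b : ℤ} {k : ℕ} (hk : 2 ≤ k) (τ : ℍ) (m : ℤ) :
    Summable (hTerm N a b k τ m) := by
  refine Summable.of_norm_bounded (summable_inv_add_int_pow hk (m * τ)).norm fun n ↦ ?_
  rw [hTerm_eq (by omega), norm_mul, norm_cis_int_div_nat, norm_div, norm_cis_int_div_nat, norm_div,
    norm_one, one_mul]

theorem hTerm_S {N : ℕ} {a b : ℤ} {k : ℕ} (hk : k ≠ 0) (τ : ℍ) (m n : ℤ) :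
    hTerm N b (-a) k τ n m =
      hTerm N a b k ⟨(-τ : ℂ)⁻¹, τ.im_inv_neg_coe_pos⟩ (-m) n * ((τ : ℂ) ^ k)⁻¹ := by
  have hτ := τ.ne_zero
  rw [hTerm_eq hk, hTerm_eq hk, ← mul_div_assoc, ← mul_div_assoc, ← cis_add, ← cis_add,
    ← div_eq_mul_inv, div_div, ← mul_pow]
  congr 2
  · push_cast; ring
  · push_cast; field_simp; ring

/-- The behaviour of the Eisenstein series under `τ ↦ -1 / τ`. -/
theorem eisH_slash_S {N : ℕ} (hN : N ≠ 0) (a b : ℤ) {k : ℕ} (hk : 2 ≤ k)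
    (h2 : k = 2 → ¬ ((N : ℤ) ∣ a ∧ (N : ℤ) ∣ b)) :
    eisH N a b k ∣[(k : ℤ)] ModularGroup.S = eisH N b (-a) k := by
  ext τ
  rw [SlashInvariantForm.slash_S_apply]
  set σ : ℍ := ⟨(-τ : ℂ)⁻¹, τ.im_inv_neg_coe_pos⟩
  have hS (m n : ℤ) : hTerm N b (-a) k τ n m = hTerm N a b k σ (-m) n * ((τ : ℂ) ^ k)⁻¹ :=
    hTerm_S (by omega) τ m n
  -- Up to a sign of one index, `S` exchanges the roles of `m` and `n`; only the order of the two
  -- summations remains to be changed.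
  have hleft : eisH N a b k σ * (τ : ℂ) ^ (-(k : ℤ)) = ∑' n, ∑' m, hTerm N b (-a) k τ m n := by
    rw [eisH, ← (Equiv.neg ℤ).tsum_eq, zpow_neg, zpow_natCast, ← tsum_mul_right]
    refine tsum_congr fun n ↦ ?_
    rw [← tsum_mul_right]
    exact tsum_congr fun m ↦ (hS n m).symm
  rw [hleft, eisH]
  rcases hk.eq_or_lt with rfl | hk3
  · have hdvd : ¬ ((N : ℤ) ∣ b ∧ (N : ℤ) ∣ -a) := fun h ↦ h2 rfl ⟨(dvd_neg).1 h.2, h.1⟩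
    refine tsum_tsum_comm_of_blocks hN (fun m ↦ summable_hTerm_row le_rfl τ m) (fun n ↦ ?_)
      (summable_tsum_hTerm hN b (-a) le_rfl τ) ?_ (summable_hTerm_blocks hN hdvd τ)
    · simp_rw [hS]
      exact (summable_hTerm_row le_rfl σ (-n)).mul_right _
    · simp_rw [hS, tsum_mul_right]
      exact ((Equiv.neg ℤ).summable_iff.2 (summable_tsum_hTerm hN a b le_rfl σ)).mul_right _
  · exact Summable.tsum_comm (f := fun m n ↦ hTerm N b (-a) k τ m n)
      (summable_hTerm N b (-a) k hk3 τ)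

/-! ### The Mellin transform of a functional-equation pair, cut at `1` -/

section FEPair

variable (P : WeakFEPair ℂ)

theorem mellinConvergent_f_modif (s : ℂ) : MellinConvergent P.f_modif s :=
  (P.isStrongFEPair_toStrongFEPair.hasMellin s).1

theorem mellinConvergent_indicator (s : ℂ) :
    MellinConvergent ((Set.Ioi 1).indicator fun x ↦ P.f x - P.f₀) s := by
  refine ((mellinConvergent_f_modif P s).indicator
    (measurableSet_Ioi (a := (1 : ℝ)))).congr (ae_of_all _ fun x ↦ ?_)
  by_cases hx : x ∈ Set.Ioi (1 : ℝ)
  · have hx' : x ∉ Set.Ioo (0 : ℝ) 1 := fun h ↦ lt_asymm h.2 hx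
    simp only [WeakFEPair.f_modif, Set.indicator_of_mem hx, Pi.add_apply,
      Set.indicator_of_notMem hx', add_zero]
  · simp only [Set.indicator_of_notMem hx, smul_zero]

theorem integrableOn_cpow_mul_sub (s : ℂ) :
    IntegrableOn (fun x : ℝ ↦ (x : ℂ) ^ (s - 1) * (P.f x - P.f₀)) (Set.Ioi 1) := by
  have h := (mellinConvergent_indicator P s).mono_set (Set.Ioi_subset_Ioi zero_le_one)
  refine h.congr_fun (fun x hx ↦ ?_) measurableSet_Ioi
  simp only [Set.indicator_of_mem hx, smul_eq_mul]

theorem mellin_indicator (s : ℂ) :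
    mellin ((Set.Ioi 1).indicator fun x ↦ P.f x - P.f₀) s =
      ∫ x in Set.Ioi (1 : ℝ), (x : ℂ) ^ (s - 1) * (P.f x - P.f₀) := by
  have hI : Set.Ioi (0 : ℝ) ∩ Set.Ioi 1 = Set.Ioi 1 :=
    Set.inter_eq_right.2 (Set.Ioi_subset_Ioi zero_le_one)
  refine Eq.trans ?_ ((setIntegral_indicator (s := Set.Ioi (0 : ℝ)) (measurableSet_Ioi
    (a := (1 : ℝ)))).trans (by rw [hI]))
  refine setIntegral_congr_fun measurableSet_Ioi fun x _ ↦ ?_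
  by_cases hx : x ∈ Set.Ioi (1 : ℝ)
  · simp only [Set.indicator_of_mem hx, smul_eq_mul]
  · simp only [Set.indicator_of_notMem hx, smul_zero]

/-- The entire part of the completed Mellin transform as an integral over `(1, ∞)`. -/
theorem Λ₀_eq_integral (s : ℂ) :
    P.Λ₀ s = (∫ x in Set.Ioi (1 : ℝ), (x : ℂ) ^ (s - 1) * (P.f x - P.f₀)) +
      P.ε * ∫ x in Set.Ioi (1 : ℝ), (x : ℂ) ^ (P.k - s - 1) * (P.g x - P.g₀) := by
  set A : ℝ → ℂ := (Set.Ioi 1).indicator fun x ↦ P.f x - P.f₀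
  set B : ℝ → ℂ := (Set.Ioi 1).indicator fun x ↦ P.g x - P.g₀
  have hA : MellinConvergent A s := mellinConvergent_indicator P s
  have hsub := (hasMellin_sub (mellinConvergent_f_modif P s) hA).2
  have h1 : mellin (fun x ↦ P.f_modif x - A x) s = P.ε * mellin B (P.k - s) := by
    -- The substitution `x ↦ 1/x` moves the part of `f_modif` on `(0,1)` to `(1,∞)`, where the
    -- functional equation rewrites it through `g - g₀`.
    rw [← neg_neg s, ← mellin_comp_inv, mellin, mellin, ← integral_const_mul, neg_neg]
    refine setIntegral_congr_fun measurableSet_Ioi fun x (hx : 0 < x) ↦ ?_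
    have hx0 : (x : ℂ) ≠ 0 := by exact_mod_cast hx.ne'
    by_cases hx1 : 1 < x
    · have hxi : x⁻¹ ∈ Set.Ioo (0 : ℝ) 1 := ⟨inv_pos.2 hx, inv_lt_one_of_one_lt₀ hx1⟩
      have hxi' : x⁻¹ ∉ Set.Ioi (1 : ℝ) := fun h ↦ lt_asymm hxi.2 h
      have hf := P.h_feq x hx
      rw [one_div] at hf
      simp only [WeakFEPair.f_modif, A, B, Pi.add_apply, Set.indicator_of_mem hxi,
        Set.indicator_of_notMem hxi', Set.indicator_of_mem (show x ∈ Set.Ioi (1 : ℝ) from hx1),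
        hf, smul_eq_mul, Real.inv_rpow hx.le, Real.rpow_neg hx.le, inv_inv, zero_add, sub_zero]
      rw [show (P.k : ℂ) - s - 1 = (-s - 1) + P.k by ring, Complex.cpow_add _ _ hx0,
        Complex.ofReal_cpow hx.le]
      ring
    · have hx1' : x ∉ Set.Ioi (1 : ℝ) := hx1
      rcases (not_lt.1 hx1).eq_or_lt with rfl | hlt
      -- At `x = 1` all the indicators are of open intervals ending there, so everything vanishes.
      · simp [WeakFEPair.f_modif, A, B]
      · have hxi : x⁻¹ ∈ Set.Ioi (1 : ℝ) := (one_lt_inv₀ hx).2 hlt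
        have hxi' : x⁻¹ ∉ Set.Ioo (0 : ℝ) 1 := fun h ↦ lt_asymm h.2 hxi
        simp only [WeakFEPair.f_modif, A, B, Pi.add_apply, Set.indicator_of_mem hxi,
          Set.indicator_of_notMem hxi', Set.indicator_of_notMem hx1', add_zero, sub_self,
          smul_zero, mul_zero]
  have h2 : mellin B (P.k - s) =
      ∫ x in Set.Ioi (1 : ℝ), (x : ℂ) ^ (P.k - s - 1) * (P.g x - P.g₀) :=
    mellin_indicator P.symm (P.k - s)
  rw [← mellin_indicator, ← h2, ← h1, hsub, WeakFEPair.Λ₀]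
  ring

end FEPair

/-! ### The pair formed by two Eisenstein series -/

theorem im_ofReal_mul_I (y : ℝ) : ((y : ℂ) * Complex.I).im = y := by simp

theorem isBigO_eisH {N : ℕ} (hN : N ≠ 0) (a b : ℤ) {k : ℕ} (hk : 2 ≤ k) (r : ℝ) :
    (fun y : ℝ ↦ eisH N a b k (ofComplex (y * Complex.I)) - eisConst N a k) =O[atTop]
      (fun y ↦ y ^ r) := by
  obtain ⟨D, hD⟩ := exists_norm_eisH_sub_le hN a b hk
  have hN' : (0 : ℝ) < N := by exact_mod_cast Nat.pos_of_ne_zero hN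
  have hc : 0 < 2 * Real.pi / N := by have := Real.pi_pos; positivity
  refine Asymptotics.IsBigO.trans ?_ (isLittleO_exp_neg_mul_rpow_atTop hc r).isBigO
  refine Asymptotics.IsBigO.of_bound D ?_
  filter_upwards [eventually_ge_atTop 1] with y hy
  have hy0 : 0 < ((y : ℂ) * Complex.I).im := by rw [im_ofReal_mul_I]; linarith
  have h := hD (ofComplex (y * Complex.I))
  rw [ofComplex_apply_of_im_pos hy0] at h ⊢
  have him : UpperHalfPlane.im ⟨(y : ℂ) * Complex.I, hy0⟩ = y := im_ofReal_mul_I y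
  rw [him] at h
  rw [Real.norm_of_nonneg (Real.exp_pos _).le]
  exact h hy

theorem continuousOn_eisH_mul_I {N : ℕ} (hN : N ≠ 0) (a b : ℤ) {k : ℕ} (hk : 2 ≤ k) :
    ContinuousOn (fun y : ℝ ↦ eisH N a b k (ofComplex (y * Complex.I))) (Set.Ioi 0) := by
  refine (continuousOn_eisH hN a b hk).comp (f := fun y : ℝ ↦ (y : ℂ) * Complex.I)
    (by fun_prop) fun y hy ↦ ?_
  simpa using hy

theorem eisH_inv_mul_I {N : ℕ} (hN : N ≠ 0) (a b : ℤ) {k : ℕ} (hk : 2 ≤ k)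
    (h2 : k = 2 → ¬ ((N : ℤ) ∣ a ∧ (N : ℤ) ∣ b)) {x : ℝ} (hx : 0 < x) :
    eisH N a b k (ofComplex ((1 / x : ℝ) * Complex.I)) =
      Complex.I ^ k * (x : ℂ) ^ k * eisH N b (-a) k (ofComplex (x * Complex.I)) := by
  have hx0 : (x : ℂ) ≠ 0 := by exact_mod_cast hx.ne'
  have hxi : 0 < ((x : ℂ) * Complex.I).im := by rwa [im_ofReal_mul_I]
  have hyi : 0 < (((1 / x : ℝ) : ℂ) * Complex.I).im := by rw [im_ofReal_mul_I]; positivity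
  have hxI : ((x : ℂ) * Complex.I) ^ k ≠ 0 := pow_ne_zero _ (mul_ne_zero hx0 Complex.I_ne_zero)
  have hcoe : (-((x : ℂ) * Complex.I))⁻¹ = (1 / x : ℝ) * Complex.I := by
    rw [← mul_neg, mul_inv, inv_neg, Complex.inv_I]
    push_cast
    rw [neg_neg, one_div]
  rw [← eisH_slash_S hN a b hk h2, SlashInvariantForm.slash_S_apply, ofComplex_apply_of_im_pos hxi,
    ofComplex_apply_of_im_pos hyi, zpow_neg, zpow_natCast]
  simp only [hcoe]
  rw [← mul_pow, mul_comm Complex.I]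
  field_simp

/-- The Eisenstein series `H_k^{(a,b)}` and `H_k^{(b,-a)}` on the imaginary axis form a pair
satisfying a functional equation. -/
noncomputable def eisPair {N : ℕ} (hN : N ≠ 0) (a b : ℤ) {k : ℕ} (hk : 2 ≤ k)
    (h2 : k = 2 → ¬ ((N : ℤ) ∣ a ∧ (N : ℤ) ∣ b)) : WeakFEPair ℂ where
  f y := eisH N a b k (ofComplex (y * Complex.I))
  g y := eisH N b (-a) k (ofComplex (y * Complex.I))
  k := k
  ε := Complex.I ^ k
  f₀ := eisConst N a k
  g₀ := eisConst N b k
  hf_int := (continuousOn_eisH_mul_I hN a b hk).locallyIntegrableOn measurableSet_Ioi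
  hg_int := (continuousOn_eisH_mul_I hN b (-a) hk).locallyIntegrableOn measurableSet_Ioi
  hk := by positivity
  hε := pow_ne_zero _ Complex.I_ne_zero
  h_feq x hx := by
    rw [eisH_inv_mul_I hN a b hk h2 hx, Real.rpow_natCast, Complex.ofReal_pow, smul_eq_mul]
  hf_top := isBigO_eisH hN a b hk
  hg_top := isBigO_eisH hN b (-a) hk

theorem hTerm_neg {N : ℕ} {a b : ℤ} {k : ℕ} (hk : k ≠ 0) (τ : ℍ) (m n : ℤ) :
    hTerm N (-a) (-b) k τ (-m) (-n) = (-1) ^ k * hTerm N a b k τ m n := by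
  have h : (((-m : ℤ) : ℂ) * τ + (-n : ℤ)) ^ k = (-1) ^ k * ((m : ℂ) * τ + n) ^ k := by
    rw [← mul_pow]; congr 1; push_cast; ring
  have h2 : ((-1 : ℂ) ^ k)⁻¹ = (-1) ^ k := by rw [← inv_pow]; norm_num
  rw [hTerm_eq hk, hTerm_eq hk, h, div_mul_eq_div_div, div_eq_mul_inv _ ((-1 : ℂ) ^ k), h2,
    neg_mul_neg, neg_mul_neg]
  ring

theorem eisH_neg {N : ℕ} (a b : ℤ) {k : ℕ} (hk : k ≠ 0) :
    eisH N (-a) (-b) k = fun τ ↦ (-1) ^ k * eisH N a b k τ := by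
  ext τ
  rw [eisH, eisH, ← (Equiv.neg ℤ).tsum_eq, ← tsum_mul_left]
  refine tsum_congr fun m ↦ ?_
  rw [← (Equiv.neg ℤ).tsum_eq, ← tsum_mul_left]
  exact tsum_congr fun n ↦ hTerm_neg hk τ m n

/-- The constant term is the limit at `i∞`, so the parity of the series passes to it by uniqueness
of limits. -/
theorem eisConst_neg {N : ℕ} (hN : N ≠ 0) (a : ℤ) {k : ℕ} (hk : 2 ≤ k) :
    eisConst N (-a) k = (-1) ^ k * eisConst N a k := by
  have h := tendsto_eisH hN (-a) (-0) hk
  rw [eisH_neg a 0 (by omega)] at h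
  exact tendsto_nhds_unique h ((tendsto_eisH hN a 0 hk).const_mul _)

/-! ### Regularised integrals as values of `Λ` -/

section Integrals

variable {N : ℕ} (a b : ℤ) {k : ℕ}

/-- On the path from `i` the variable is `(t+1) i`; collecting the powers of `i` leaves a Mellin
integrand on `(1,∞)` after the shift `x = t + 1`. -/
theorem tailIntegrand_eisH (hN : N ≠ 0) (hk : 2 ≤ k) (p : ℕ) (t : ℝ) :
    tailIntegrand (eisH N a b k) UpperHalfPlane.I p t = Complex.I ^ (p + 1) *
      (((t + 1 : ℝ) : ℂ) ^ p *
        (eisH N a b k (ofComplex ((t + 1 : ℝ) * Complex.I)) - eisConst N a k)) := by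
  rw [tailIntegrand, valueAtInfty_eisH hN a b hk, UpperHalfPlane.coe_I,
    show Complex.I + t * Complex.I = (t + 1 : ℝ) * Complex.I by push_cast; ring, mul_pow]
  ring

theorem integrableOn_pow_mul_eisH (hN : N ≠ 0) (hk : 2 ≤ k)
    (h2 : k = 2 → ¬ ((N : ℤ) ∣ a ∧ (N : ℤ) ∣ b)) (p : ℕ) :
    IntegrableOn (fun x : ℝ ↦ (x : ℂ) ^ p *
      (eisH N a b k (ofComplex (x * Complex.I)) - eisConst N a k)) (Set.Ioi 1) := by
  have h := integrableOn_cpow_mul_sub (eisPair hN a b hk h2) (p + 1)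
  simp only [add_sub_cancel_right, Complex.cpow_natCast] at h
  exact h

theorem preimage_add_one_Ioi : (fun x : ℝ ↦ x + 1) ⁻¹' Set.Ioi 1 = Set.Ioi 0 := by
  ext x; simp

theorem regIntegralConverges_eisH (hN : N ≠ 0) (hk : 2 ≤ k)
    (h2 : k = 2 → ¬ ((N : ℤ) ∣ a ∧ (N : ℤ) ∣ b)) (p : ℕ) :
    RegIntegralConverges (eisH N a b k) UpperHalfPlane.I p := by
  refine ⟨by rw [valueAtInfty_eisH hN a b hk]; exact tendsto_eisH hN a b hk, ?_⟩
  have h := ((measurePreserving_add_right volume (1 : ℝ)).integrableOn_comp_preimage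
    (measurableEmbedding_addRight 1)).2 (integrableOn_pow_mul_eisH a b hN hk h2 p)
  rw [preimage_add_one_Ioi] at h
  rw [funext (tailIntegrand_eisH a b hN hk p)]
  exact Integrable.const_mul h _

theorem regIntegral_eisH (hN : N ≠ 0) (hk : 2 ≤ k) (p : ℕ) :
    regIntegral (eisH N a b k) UpperHalfPlane.I p = Complex.I ^ (p + 1) *
      (-(eisConst N a k / (p + 1)) + ∫ x in Set.Ioi (1 : ℝ), (x : ℂ) ^ p *
      (eisH N a b k (ofComplex (x * Complex.I)) - eisConst N a k)) := by
  have h := (measurePreserving_add_right volume (1 : ℝ)).setIntegral_preimage_emb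
    (measurableEmbedding_addRight 1) (fun x : ℝ ↦ (x : ℂ) ^ p *
      (eisH N a b k (ofComplex (x * Complex.I)) - eisConst N a k)) (Set.Ioi 1)
  rw [preimage_add_one_Ioi] at h
  rw [regIntegral, valueAtInfty_eisH hN a b hk, UpperHalfPlane.coe_I,
    funext (tailIntegrand_eisH a b hN hk p), integral_const_mul, h]
  ring

theorem completedLConverges_eisH (hN : N ≠ 0) (hk : 2 ≤ k)
    (h2 : k = 2 → ¬ ((N : ℤ) ∣ a ∧ (N : ℤ) ∣ b)) (l : ℕ) :
    CompletedLConverges (eisH N a b k) k l := by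
  rw [CompletedLConverges, eisH_slash_S hN a b hk h2]
  exact ⟨regIntegralConverges_eisH _ _ hN hk
    (fun h h' ↦ h2 h ⟨dvd_neg.1 h'.2, h'.1⟩) _, regIntegralConverges_eisH _ _ hN hk h2 _⟩

/-- The completed `L`-value is, up to a power of `i`, a value of the meromorphic continuation of
the Mellin transform. -/
theorem completedL_eisH_eq_Λ (hN : N ≠ 0) (hk : 2 ≤ k)
    (h2 : k = 2 → ¬ ((N : ℤ) ∣ a ∧ (N : ℤ) ∣ b)) {l : ℕ} (hl : 1 ≤ l) (hlk : l < k) :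
    completedL (eisH N a b k) k l = Complex.I ^ l * (eisPair hN a b hk h2).Λ l := by
  rw [completedL, eisH_slash_S hN a b hk h2, regIntegral_eisH _ _ hN hk,
    regIntegral_eisH _ _ hN hk, WeakFEPair.Λ, Λ₀_eq_integral]
  obtain ⟨p, rfl⟩ : ∃ p, l = p + 1 := ⟨l - 1, by omega⟩
  obtain ⟨q, rfl⟩ : ∃ q, k = p + 1 + (q + 1) := ⟨k - (p + 1) - 1, by omega⟩
  simp only [eisPair, smul_eq_mul]
  rw [show p + 1 + (q + 1) - (p + 1) - 1 = q by omega, show p + 1 - 1 = p by omega]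
  push_cast
  rw [show (p + 1 + (q + 1) - (p + 1) : ℂ) = q + 1 by ring]
  simp only [add_sub_cancel_right, Complex.cpow_natCast]
  -- In terms of `k` and `l` this reads `i^l ε = (-1)^l i^(k-l)` with `ε = i^k`: the sign of the
  -- integral from the cusp `0` is the root number of the pair.
  have hI : Complex.I ^ (p + 1) * Complex.I ^ (p + 1 + (q + 1)) =
      (-1) ^ (p + 1) * Complex.I ^ (q + 1) := by
    rw [← Complex.I_sq]; ring
  linear_combination (-1 : ℂ) * (-(eisConst N b (p + 1 + (q + 1)) / (q + 1)) +
    ∫ x in Set.Ioi (1 : ℝ), (x : ℂ) ^ q *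
      (eisH N b (-a) (p + 1 + (q + 1)) (ofComplex (x * Complex.I)) -
        eisConst N b (p + 1 + (q + 1)))) * hI

/-- The functional equation of the completed `L`-values. -/
theorem completedL_eisH_symm (hN : N ≠ 0) (hk : 2 ≤ k)
    (h2 : k = 2 → ¬ ((N : ℤ) ∣ a ∧ (N : ℤ) ∣ b)) {l : ℕ} (hl : 1 ≤ l) (hlk : l < k) :
    completedL (eisH N b (-a) k) k (k - l) = (-1) ^ l * completedL (eisH N a b k) k l := by
  have h2' : k = 2 → ¬ ((N : ℤ) ∣ b ∧ (N : ℤ) ∣ -a) :=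
    fun h h' ↦ h2 h ⟨dvd_neg.1 h'.2, h'.1⟩
  -- Applying `S` twice replaces `(a,b)` by `(-a,-b)`, which costs only `(-1)^k`.
  have hreg : regIntegral (eisH N (-a) (-b) k) UpperHalfPlane.I (l - 1) =
      (-1) ^ k * regIntegral (eisH N a b k) UpperHalfPlane.I (l - 1) := by
    rw [regIntegral_eisH _ _ hN hk, regIntegral_eisH _ _ hN hk, eisConst_neg hN a hk,
      eisH_neg a b (by omega)]
    simp_rw [← mul_sub, mul_left_comm _ ((-1 : ℂ) ^ k), integral_const_mul]
    ring
  have hsign : (-1 : ℂ) ^ (k - l) * (-1) ^ k = (-1) ^ l := by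
    obtain ⟨q, rfl⟩ : ∃ q, k = l + q := ⟨k - l, by omega⟩
    rw [show l + q - l = q by omega, pow_add, mul_left_comm, ← mul_pow]
    norm_num
  have hsq : (-1 : ℂ) ^ l * (-1) ^ l = 1 := by rw [← mul_pow]; norm_num
  rw [completedL, completedL, eisH_slash_S hN a b hk h2, eisH_slash_S hN b (-a) hk h2',
    show k - (k - l) - 1 = l - 1 by omega, hreg, ← mul_assoc, hsign]
  linear_combination (-regIntegral (eisH N b (-a) k) UpperHalfPlane.I (k - l - 1)) * hsq

end Integrals

/-! ### The Dirichlet series and its continuation -/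

theorem cpow_natCast_mul_natCast_mul {c : ℝ} (hc : 0 < c) (m r : ℕ) (s : ℂ) :
    ((c * (m * r) : ℝ) : ℂ) ^ s = (c : ℂ) ^ s * ((m : ℂ) ^ s * (r : ℂ) ^ s) := by
  push_cast
  have h1 := Complex.mul_cpow_ofReal_nonneg hc.le (b := m * r) (by positivity) s
  have h2 := Complex.mul_cpow_ofReal_nonneg (Nat.cast_nonneg' m) (b := r) (Nat.cast_nonneg' r) s
  push_cast at h1 h2
  rw [h1, h2]

/-- This normalises a progression modulo `N` to a Hurwitz series with parameter `α/N`. The condition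
on `s` makes the term `α = t = 0` vanish on both sides. -/
theorem natCast_pow_div_cpow {N : ℕ} (hN : N ≠ 0) (α t : ℕ) {k : ℕ} (hk : 2 ≤ k) {s : ℂ}
    (hs : s - k + 1 ≠ 0) :
    ((α + N * t : ℕ) : ℂ) ^ (k - 1) / ((α + N * t : ℕ) : ℂ) ^ s =
      (N : ℂ) ^ (k - 1 - s) * (1 / (t + (α / N : ℝ) : ℂ) ^ (s - k + 1)) := by
  have hN' : (N : ℂ) ≠ 0 := by exact_mod_cast hN
  have hNr : (N : ℝ) ≠ 0 := by exact_mod_cast hN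
  rcases Nat.eq_zero_or_pos (α + N * t) with h | h
  · have h1 : α = 0 := by omega
    have h2 : t = 0 := by
      have : N * t = 0 := by omega
      exact (Nat.mul_eq_zero.1 this).resolve_left hN
    simp [h1, h2, show k - 1 ≠ 0 by omega, Complex.zero_cpow hs]
  · have hr : ((α + N * t : ℕ) : ℂ) ≠ 0 := by exact_mod_cast h.ne'
    have hr2 : ((α + N * t : ℕ) : ℂ) = ((N : ℝ) : ℂ) * ((t + α / N : ℝ) : ℂ) := by
      push_cast; field_simp; ring
    rw [← Complex.cpow_natCast, ← Complex.cpow_sub _ _ hr, Nat.cast_sub (by omega), Nat.cast_one,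
      hr2, Complex.mul_cpow_ofReal_nonneg (Nat.cast_nonneg' N) (by positivity), one_div,
      ← Complex.cpow_neg]
    congr 2
    · push_cast; rfl
    · ring

theorem hasSum_expZeta_succ (β : ℝ) {s : ℂ} (hs : 1 < s.re) :
    HasSum (fun m : ℕ ↦ cis ((m + 1 : ℕ) * β) / ((m + 1 : ℕ) : ℂ) ^ s) (expZeta β s) := by
  have h := (hasSum_nat_add_iff' 1).2 (hasSum_expZeta_of_one_lt_re β hs)
  have hs0 : s ≠ 0 := by rintro rfl; simp at hs; linarith
  simp only [Finset.range_one, Finset.sum_singleton, Nat.cast_zero, Complex.zero_cpow hs0, div_zero,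
    sub_zero] at h
  refine h.congr_fun fun m ↦ ?_
  rw [cis]; ring_nf

theorem hasSum_expZeta_mul_hurwitzZeta {N : ℕ} (hN : N ≠ 0) {α : ℕ} (hα : α < N) (β : ℤ) {k : ℕ}
    (hk : 2 ≤ k) {s : ℂ} (hs : k < s.re) :
    HasSum (fun p : ℕ × ℕ ↦ cis (((p.1 + 1) * β : ℤ) / N) *
        ((α + N * p.2 : ℕ) : ℂ) ^ (k - 1) /
        ((2 * Real.pi / N * ((p.1 + 1 : ℕ) * (α + N * p.2 : ℕ)) : ℝ) : ℂ) ^ s)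
      (((2 * Real.pi / N : ℝ) : ℂ) ^ (-s) * (N : ℂ) ^ (k - 1 - s) *
        (expZeta (β / N : ℝ) s * hurwitzZeta (α / N : ℝ) (s - k + 1))) := by
  have hN' : (0 : ℝ) < N := by exact_mod_cast Nat.pos_of_ne_zero hN
  have hk1 : (2 : ℝ) ≤ k := by exact_mod_cast hk
  have hs1 : 1 < (s - k + 1).re := by simp; linarith
  have hs0 : s - k + 1 ≠ 0 := by intro h; rw [h] at hs1; simp at hs1; linarith
  have hα1 : ((α : ℝ) / N) ∈ Set.Icc 0 1 :=
    ⟨by positivity, (div_le_one hN').2 (by exact_mod_cast hα.le)⟩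
  have h1 := hasSum_expZeta_succ (β / N) (s := s) (by linarith)
  have h2 := hasSum_hurwitzZeta_of_one_lt_re hα1 hs1
  have hm : ∀ {f g : ℕ → ℂ} {x y : ℂ}, HasSum f x → HasSum g y →
      HasSum (fun p : ℕ × ℕ ↦ f p.1 * g p.2) (x * y) := fun hf hg ↦
    hf.mul hg (summable_mul_of_summable_norm hf.summable.norm hg.summable.norm)
  refine ((hm h1 h2).mul_left _).congr_fun fun p ↦ ?_
  have hc : 0 < 2 * Real.pi / N := by have := Real.pi_pos; positivity
  rw [cpow_natCast_mul_natCast_mul hc, Complex.cpow_neg]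
  have h3 := natCast_pow_div_cpow hN α p.2 hk hs0
  have h4 : cis (((p.1 + 1) * β : ℤ) / N) = cis ((p.1 + 1 : ℕ) * (β / N : ℝ)) := by
    congr 1; push_cast; ring
  rw [h4]
  linear_combination (((2 * Real.pi / N : ℝ) : ℂ) ^ s)⁻¹ * (cis ((p.1 + 1 : ℕ) * (β / N : ℝ)) /
    ((p.1 + 1 : ℕ) : ℂ) ^ s) * h3

theorem qTerm_mul_I (N α : ℕ) (β : ℤ) (k : ℕ) (y : ℝ) (p : ℕ × ℕ) :
    qTerm N α β k (y * Complex.I) p =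
      cis (((p.1 + 1) * β : ℤ) / N) * ((α + N * p.2 : ℕ) : ℂ) ^ (k - 1) *
        Real.exp (-(2 * Real.pi / N * ((p.1 + 1 : ℕ) * (α + N * p.2 : ℕ))) * y) := by
  rw [qTerm]
  congr 1
  rw [cis, Complex.ofReal_exp]
  congr 1
  push_cast
  linear_combination (2 * Real.pi * ((p.1 + 1) * (α + N * p.2)) * (y / N) : ℂ) * Complex.I_sq

/-- The Dirichlet series attached to the Eisenstein series, without its constants. -/
noncomputable def eisDirichlet (A B : UnitAddCircle) (k : ℕ) (s : ℂ) : ℂ :=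
  expZeta B s * hurwitzZeta A (s - k + 1) +
    (-1) ^ k * (expZeta (-B) s * hurwitzZeta (-A) (s - k + 1))

theorem unitAddCircle_div_eq {N : ℕ} (hN : N ≠ 0) {α : ℕ} {a : ℤ} (h : (N : ℤ) ∣ α - a) :
    ((α / N : ℝ) : UnitAddCircle) = ((a / N : ℝ) : UnitAddCircle) := by
  have hN' : (N : ℝ) ≠ 0 := by exact_mod_cast hN
  obtain ⟨d, hd⟩ := h
  have h1 : (α : ℝ) = a + N * d := by
    have : (α : ℤ) = a + N * d := by linarith
    exact_mod_cast this
  rw [h1, add_div, mul_div_cancel_left₀ _ hN', AddCircle.coe_add]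
  have : ((d : ℝ) : UnitAddCircle) = 0 := by
    rw [AddCircle.coe_eq_zero_iff]
    exact ⟨d, by simp⟩
  rw [this, add_zero]

theorem Λ_eisPair_of_lt_re {N : ℕ} (hN : N ≠ 0) (a b : ℤ) {k : ℕ} (hk : 2 ≤ k)
    (h2 : k = 2 → ¬ ((N : ℤ) ∣ a ∧ (N : ℤ) ∣ b)) {s : ℂ} (hs : k < s.re) :
    (eisPair hN a b hk h2).Λ s = Complex.Gamma s * (lipschitzConst N k *
      (((2 * Real.pi / N : ℝ) : ℂ) ^ (-s) * (N : ℂ) ^ (k - 1 - s) *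
        eisDirichlet (a / N : ℝ) (b / N : ℝ) k s)) := by
  have hN' : (0 : ℝ) < N := by exact_mod_cast Nat.pos_of_ne_zero hN
  have hc : 0 < 2 * Real.pi / N := by have := Real.pi_pos; positivity
  obtain ⟨α, hα, haα⟩ := exists_residue hN a
  obtain ⟨α', hα', haα'⟩ := exists_residue_neg hN a
  have hA := unitAddCircle_div_eq hN haα
  have hA' := unitAddCircle_div_eq hN (α := α') (a := -a) (by simpa using haα')
  rw [Int.cast_neg, neg_div, AddCircle.coe_neg] at hA'
  -- The two residue classes `±a` are merged into one generalised Dirichlet series indexed by a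
  -- disjoint union, so that a single termwise Mellin transform suffices.
  let c₀ (γ : ℕ) (β : ℤ) (p : ℕ × ℕ) : ℂ :=
    cis (((p.1 + 1) * β : ℤ) / N) * ((γ + N * p.2 : ℕ) : ℂ) ^ (k - 1)
  let q₀ (γ : ℕ) (p : ℕ × ℕ) : ℝ := 2 * Real.pi / N * ((p.1 + 1 : ℕ) * (γ + N * p.2 : ℕ))
  let c : (ℕ × ℕ) ⊕ (ℕ × ℕ) → ℂ := Sum.elim (fun p ↦ lipschitzConst N k * c₀ α b p)
    fun p ↦ lipschitzConst N k * ((-1) ^ k * c₀ α' (-b) p)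
  let q : (ℕ × ℕ) ⊕ (ℕ × ℕ) → ℝ := Sum.elim (q₀ α) (q₀ α')
  -- A zero frequency occurs only for `γ = t = 0`, and there the coefficient `0 ^ (k-1)` vanishes.
  have hpos (γ : ℕ) (β : ℤ) (p : ℕ × ℕ) : c₀ γ β p = 0 ∨ 0 < q₀ γ p := by
    rcases Nat.eq_zero_or_pos (γ + N * p.2) with h | h
    · left; simp only [c₀, h, Nat.cast_zero, zero_pow (show k - 1 ≠ 0 by omega), mul_zero]
    · right
      have : (0 : ℝ) < (γ + N * p.2 : ℕ) := by exact_mod_cast h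
      positivity
  have hnonneg (i) : 0 ≤ q i := by
    rcases i with p | p <;> simp only [q, q₀, Sum.elim_inl, Sum.elim_inr] <;> positivity
  have hD : HasSum (fun i ↦ c i / (q i : ℂ) ^ s) (lipschitzConst N k *
      (((2 * Real.pi / N : ℝ) : ℂ) ^ (-s) * (N : ℂ) ^ (k - 1 - s) *
        eisDirichlet (a / N : ℝ) (b / N : ℝ) k s)) := by
    have e1 := hasSum_expZeta_mul_hurwitzZeta hN hα b hk hs
    have e2 := hasSum_expZeta_mul_hurwitzZeta hN hα' (-b) hk hs
    rw [hA] at e1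
    rw [hA', Int.cast_neg, neg_div, AddCircle.coe_neg] at e2
    have e3 := HasSum.sum (f := fun i ↦ c i / (q i : ℂ) ^ s)
      ((e1.mul_left (lipschitzConst N k)).congr_fun fun p ↦ by
        simp only [Function.comp_apply, c, q, c₀, q₀, Sum.elim_inl, mul_div_assoc])
      ((e2.mul_left (lipschitzConst N k * (-1) ^ k)).congr_fun fun p ↦ by
        simp only [Function.comp_apply, c, q, c₀, q₀, Sum.elim_inr, mul_div_assoc, mul_assoc])
    rw [eisDirichlet, mul_add, mul_add]
    refine (congrArg (HasSum _ · _) ?_).mp e3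
    ring
  have hF (t : ℝ) (ht : 0 < t) : HasSum (fun i ↦ c i * Real.exp (-q i * t))
      (eisH N a b k (ofComplex (t * Complex.I)) - eisConst N a k) := by
    have him : 0 < ((t : ℂ) * Complex.I).im := by rwa [im_ofReal_mul_I]
    have e1 := (summable_qTerm hN α b hk him).hasSum
    have e2 := (summable_qTerm hN α' (-b) hk him).hasSum
    have e3 := HasSum.sum (f := fun i ↦ c i * Real.exp (-q i * t))
      ((e1.mul_left (lipschitzConst N k)).congr_fun fun p ↦ by
        simp only [Function.comp_apply, c, q, c₀, q₀, Sum.elim_inl, qTerm_mul_I, mul_assoc])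
      ((e2.mul_left (lipschitzConst N k * (-1) ^ k)).congr_fun fun p ↦ by
        simp only [Function.comp_apply, c, q, c₀, q₀, Sum.elim_inr, qTerm_mul_I, mul_assoc])
    rw [eisH_eq hN a b hk hα haα hα' haα', ofComplex_apply_of_im_pos him]
    refine (congrArg (HasSum _ · _) ?_).mp e3
    simp only [qSer]
    ring
  have hM := hasSum_mellin (a := c) (p := q) (s := s)
    (fun i ↦ by
      rcases i with p | p
      · exact (hpos α b p).imp_left fun h ↦ by simp [c, h]
      · exact (hpos α' (-b) p).imp_left fun h ↦ by simp [c, h])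
    ((Nat.cast_nonneg k).trans_lt hs) hF
    (hD.summable.norm.congr fun i ↦ by
      rw [norm_div]
      rcases (hnonneg i).eq_or_lt with h | h
      · have hs0 : s.re ≠ 0 := ((Nat.cast_nonneg k).trans_lt hs).ne'
        have hs1 : s ≠ 0 := fun h ↦ hs0 (by rw [h]; rfl)
        rw [← h, Complex.ofReal_zero, Complex.zero_cpow hs1, Real.zero_rpow hs0, norm_zero]
      · rw [Complex.norm_cpow_eq_rpow_re_of_pos h])
  rw [← ((eisPair hN a b hk h2).hasMellin hs).2]
  refine hM.unique ?_
  exact (hD.mul_left _).congr_fun fun i ↦ mul_div_assoc _ _ _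

/-- The analytic continuation of the completed Mellin transform of the Eisenstein series. -/
theorem Λ_eisPair {N : ℕ} (hN : N ≠ 0) (a b : ℤ) {k : ℕ} (hk : 2 ≤ k)
    (h2 : k = 2 → ¬ ((N : ℤ) ∣ a ∧ (N : ℤ) ∣ b)) {s : ℂ} (hs0 : s ≠ 0) (hsk : s ≠ k)
    (hs1 : s ≠ 1 ∨ ((b / N : ℝ) : UnitAddCircle) ≠ 0) :
    (Complex.Gamma s)⁻¹ * (eisPair hN a b hk h2).Λ s = lipschitzConst N k *
      (((2 * Real.pi / N : ℝ) : ℂ) ^ (-s) * (N : ℂ) ^ (k - 1 - s) *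
        eisDirichlet (a / N : ℝ) (b / N : ℝ) k s) := by
  set A : UnitAddCircle := ((a / N : ℝ) : UnitAddCircle)
  set B : UnitAddCircle := ((b / N : ℝ) : UnitAddCircle)
  have hN' : (N : ℂ) ≠ 0 := by exact_mod_cast hN
  have hc : ((2 * Real.pi / N : ℝ) : ℂ) ≠ 0 := by
    have hNr : (N : ℝ) ≠ 0 := by exact_mod_cast hN
    exact_mod_cast div_ne_zero (mul_ne_zero two_ne_zero Real.pi_ne_zero) hNr
  -- These are the only possible singularities: the poles of `Λ`, which include the pole of the
  -- Hurwitz factor at `k`, and the pole of `expZeta 0` at `1`. Dividing by Gamma, whose inverse is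
  -- entire, avoids excluding the nonpositive integers. The complement of a finite set is connected,
  -- so the identity near `k + 1` propagates.
  set T : Set ℂ := {s | s = 0 ∨ s = k ∨ (s = 1 ∧ B = 0)}
  have hTfin : T.Finite := ((Set.finite_singleton (1 : ℂ)).insert (k : ℂ) |>.insert 0).subset (by
    rintro x (h | h | h)
    · simp [h]
    · simp [h]
    · simp [h.1])
  have hopen : IsOpen Tᶜ := hTfin.isClosed.isOpen_compl
  have hconn : IsPreconnected Tᶜ :=
    (hTfin.countable.isConnected_compl_of_one_lt_rank (by simp)).isPreconnected
  have hmem {z : ℂ} (hz : z ∈ Tᶜ) : z ≠ 0 ∧ z ≠ k ∧ (z ≠ 1 ∨ B ≠ 0) :=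
    ⟨fun h ↦ hz (.inl h), fun h ↦ hz (.inr (.inl h)), by
      by_contra! h
      exact hz (.inr (.inr h))⟩
  have hf : DifferentiableOn ℂ (fun z ↦ (Complex.Gamma z)⁻¹ * (eisPair hN a b hk h2).Λ z) Tᶜ :=
    fun z hz ↦ ((Complex.differentiable_one_div_Gamma z).mul
      ((eisPair hN a b hk h2).differentiableAt_Λ (.inl (hmem hz).1)
        (.inl (by simpa [eisPair] using (hmem hz).2.1)))).differentiableWithinAt
  have hg : DifferentiableOn ℂ (fun z : ℂ ↦ lipschitzConst N k *
      (((2 * Real.pi / N : ℝ) : ℂ) ^ (-z) * (N : ℂ) ^ (k - 1 - z) * eisDirichlet A B k z)) Tᶜ := by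
    intro z hz
    obtain ⟨-, hzk, hz1⟩ := hmem hz
    have e1 := differentiableAt_expZeta B z hz1
    have e2 := differentiableAt_expZeta (-B) z (by simpa using hz1)
    have hzk' : z - k + 1 ≠ 1 := by
      rw [Ne, add_eq_right, sub_eq_zero]; exact hzk
    have e3 (C : UnitAddCircle) : DifferentiableAt ℂ (fun z : ℂ ↦ hurwitzZeta C (z - k + 1)) z :=
      DifferentiableAt.comp z (f := fun z : ℂ ↦ z - k + 1) (differentiableAt_hurwitzZeta C hzk')
        (by fun_prop)
    have e4 : DifferentiableAt ℂ (fun z : ℂ ↦ ((2 * Real.pi / N : ℝ) : ℂ) ^ (-z)) z :=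
      (by fun_prop : DifferentiableAt ℂ (fun z : ℂ ↦ -z) z).const_cpow (.inl hc)
    have e5 : DifferentiableAt ℂ (fun z : ℂ ↦ (N : ℂ) ^ ((k : ℂ) - 1 - z)) z :=
      (by fun_prop : DifferentiableAt ℂ (fun z : ℂ ↦ (k : ℂ) - 1 - z) z).const_cpow (.inl hN')
    exact (((e4.mul e5).mul ((e1.mul (e3 A)).add
      ((e2.mul (e3 (-A))).const_mul _))).const_mul _).differentiableWithinAt
  have hk0 : (0 : ℝ) ≤ k := Nat.cast_nonneg k
  have hz₀ : ((k : ℂ) + 1) ∈ Tᶜ := by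
    rintro (h | h | h)
    · exact absurd (congrArg Complex.re h) (by simp; linarith)
    · simp at h
    · have := h.1
      simp at this
      omega
  refine (hf.analyticOnNhd hopen).eqOn_of_preconnected_of_eventuallyEq (hg.analyticOnNhd hopen)
    hconn hz₀ ?_ (show s ∈ Tᶜ from ?_)
  · have : {z : ℂ | (k : ℝ) < z.re} ∈ 𝓝 ((k : ℂ) + 1) :=
      (isOpen_lt continuous_const Complex.continuous_re).mem_nhds (by simp)
    filter_upwards [this] with z hz
    have hG : Complex.Gamma z ≠ 0 :=
      Complex.Gamma_ne_zero_of_re_pos (hk0.trans_lt hz)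
    rw [Λ_eisPair_of_lt_re hN a b hk h2 hz, inv_mul_cancel_left₀ hG]
  · rintro (h | h | h)
    · exact hs0 h
    · exact hsk h
    · exact hs1.elim (fun h' ↦ h' h.1) fun h' ↦ h' h.2

/-! ### Conditional convergence on the unit circle -/

section DirichletTest

/-- Bernoulli's inequality for `(y/x)^σ`, together with `x^σ ≤ x` for `x ≤ 1`. -/
theorem rpow_sub_rpow_le {x y σ : ℝ} (hy : 0 < y) (hyx : y ≤ x) (hx : x ≤ 1) (hσ : 1 ≤ σ) :
    x ^ σ - y ^ σ ≤ σ * (x - y) := by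
  have hx0 : 0 < x := hy.trans_le hyx
  have h1 := one_add_mul_self_le_rpow_one_add (s := y / x - 1)
    (by have := div_nonneg hy.le hx0.le; linarith) hσ
  rw [add_sub_cancel] at h1
  have h2 : y ^ σ = x ^ σ * (y / x) ^ σ := by
    rw [← Real.mul_rpow hx0.le (by positivity), mul_div_cancel₀ _ hx0.ne']
  have h3 : x ^ σ ≤ x := by
    simpa using Real.rpow_le_rpow_of_exponent_ge hx0 hx hσ
  have h4 : 0 ≤ 1 - y / x := by
    rw [sub_nonneg, div_le_one hx0]; exact hyx
  calc x ^ σ - y ^ σ = x ^ σ * (1 - (y / x) ^ σ) := by rw [h2]; ring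
    _ ≤ x ^ σ * (σ * (1 - y / x)) := by
      refine mul_le_mul_of_nonneg_left ?_ (by positivity); linarith
    _ ≤ x * (σ * (1 - y / x)) := by
      refine mul_le_mul_of_nonneg_right h3 (mul_nonneg (by linarith) h4)
    _ = σ * (x - y) := by field_simp

/-- The coefficient `1 / (i + 1) ^ σ`. -/
noncomputable def invPow (i : ℕ) (σ : ℝ) : ℝ := (1 / (i + 1 : ℝ)) ^ σ

theorem abs_invPow_succ_sub_le (i : ℕ) {σ : ℝ} (h1 : 1 ≤ σ) (h2 : σ ≤ 2) :
    |invPow (i + 1) σ - invPow i σ| ≤ 2 * (1 / (i + 1 : ℝ) ^ 2) := by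
  have hle : (1 : ℝ) / ((i + 1 : ℕ) + 1) ≤ 1 / (i + 1) := by
    refine one_div_le_one_div_of_le (by positivity) ?_; push_cast; linarith
  have hi1 : (1 : ℝ) / (i + 1) ≤ 1 := by
    rw [div_le_one (by positivity)]
    have : (0 : ℝ) ≤ i := Nat.cast_nonneg i
    linarith
  have hmono : invPow (i + 1) σ ≤ invPow i σ :=
    Real.rpow_le_rpow (by positivity) hle (by linarith)
  rw [abs_sub_comm, abs_of_nonneg (sub_nonneg.2 hmono)]
  have h := rpow_sub_rpow_le (by positivity) hle hi1 h1
  refine h.trans (mul_le_mul h2 ?_ (sub_nonneg.2 hle) zero_le_two)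
  push_cast
  rw [div_sub_div _ _ (by positivity) (by positivity), div_le_div_iff₀ (by positivity)
    (by positivity)]
  have : (0 : ℝ) ≤ i := Nat.cast_nonneg i
  nlinarith [mul_nonneg this this]

theorem tendsto_invPow {σ : ℝ} (h1 : 1 ≤ σ) : Tendsto (invPow · σ) atTop (𝓝 0) := by
  have h : Tendsto (fun i : ℕ ↦ (1 : ℝ) / (i + 1)) atTop (𝓝 0) :=
    tendsto_one_div_add_atTop_nhds_zero_nat
  refine squeeze_zero (fun i ↦ by unfold invPow; positivity) (fun i ↦ ?_) h
  have hi1 : (1 : ℝ) / (i + 1) ≤ 1 := by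
    rw [div_le_one (by positivity)]
    have : (0 : ℝ) ≤ i := Nat.cast_nonneg i
    linarith
  simpa [invPow] using Real.rpow_le_rpow_of_exponent_ge (by positivity) hi1 h1

variable {z : ℂ}

theorem norm_geom_sum_le (hz : ‖z‖ = 1) (hz1 : z ≠ 1) (n : ℕ) :
    ‖∑ i ∈ Finset.range n, z ^ (i + 1)‖ ≤ 2 / ‖z - 1‖ := by
  simp_rw [pow_succ, ← Finset.sum_mul]
  rw [geom_sum_eq hz1, norm_mul, hz, mul_one, norm_div]
  refine div_le_div_of_nonneg_right ((norm_sub_le _ _).trans ?_) (norm_nonneg _)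
  rw [norm_pow, hz]; norm_num

/-- The sum of `∑ z ^ (i + 1) / (i + 1) ^ σ` after summation by parts. -/
noncomputable def partsSum (z : ℂ) (σ : ℝ) : ℂ :=
  ∑' i : ℕ, -((invPow (i + 1) σ - invPow i σ) • ∑ j ∈ Finset.range (i + 1), z ^ (j + 1))

theorem norm_partsSum_term_le (hz : ‖z‖ = 1) (hz1 : z ≠ 1) (i : ℕ) {σ : ℝ} (h1 : 1 ≤ σ)
    (h2 : σ ≤ 2) :
    ‖-((invPow (i + 1) σ - invPow i σ) • ∑ j ∈ Finset.range (i + 1), z ^ (j + 1))‖ ≤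
      2 * (1 / (i + 1 : ℝ) ^ 2) * (2 / ‖z - 1‖) := by
  rw [norm_neg, norm_smul, Real.norm_eq_abs]
  exact mul_le_mul (abs_invPow_succ_sub_le i h1 h2) (norm_geom_sum_le hz hz1 _) (norm_nonneg _)
    (by positivity)

theorem summable_partsSum_bound (z : ℂ) :
    Summable fun i : ℕ ↦ 2 * (1 / (i + 1 : ℝ) ^ 2) * (2 / ‖z - 1‖) := by
  have h := (summable_nat_add_iff 1).2 (Real.summable_one_div_nat_pow.2 one_lt_two)
  push_cast at h
  exact (h.mul_left 2).mul_right _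

/-- After summation by parts the terms have a summable bound independent of `σ`. Hence continuity
reaches the endpoint `1`, where the original series is only conditionally convergent. -/
theorem continuousOn_partsSum (hz : ‖z‖ = 1) (hz1 : z ≠ 1) :
    ContinuousOn (partsSum z) (Set.Icc 1 2) := by
  have hc (i : ℕ) : Continuous (invPow i) := by
    unfold invPow
    exact Real.continuous_const_rpow (by positivity)
  refine continuousOn_tsum (fun i ↦ ?_) (summable_partsSum_bound z) fun i σ hσ ↦
    norm_partsSum_term_le hz hz1 i hσ.1 hσ.2
  exact (((hc (i + 1)).sub (hc i)).smul continuous_const).neg.continuousOn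

theorem tendsto_sum_partsSum (hz : ‖z‖ = 1) (hz1 : z ≠ 1) {σ : ℝ} (h1 : 1 ≤ σ) (h2 : σ ≤ 2) :
    Tendsto (fun n ↦ ∑ i ∈ Finset.range n, invPow i σ • z ^ (i + 1)) atTop (𝓝 (partsSum z σ)) := by
  rw [← tendsto_add_atTop_iff_nat 1]
  have hs := Summable.of_norm_bounded (summable_partsSum_bound z) fun i ↦
    norm_partsSum_term_le hz hz1 i h1 h2
  have h3 := hs.hasSum.tendsto_sum_nat
  have h4 : Tendsto (fun n ↦ invPow n σ • ∑ i ∈ Finset.range (n + 1), z ^ (i + 1)) atTop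
      (𝓝 0) := by
    refine squeeze_zero_norm (fun n ↦ ?_)
      (by simpa using (tendsto_invPow h1).mul_const (2 / ‖z - 1‖))
    rw [norm_smul, Real.norm_of_nonneg (by unfold invPow; positivity)]
    exact mul_le_mul_of_nonneg_left (norm_geom_sum_le hz hz1 _) (by unfold invPow; positivity)
  have h5 := h4.add h3
  rw [zero_add] at h5
  refine h5.congr fun n ↦ ?_
  rw [Finset.sum_range_by_parts, add_tsub_cancel_right, Finset.sum_neg_distrib, sub_eq_add_neg]

end DirichletTest

/-! ### The exponential zeta function at positive integers -/

theorem invPow_smul (i : ℕ) (σ : ℝ) (w : ℂ) :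
    invPow i σ • w = w / ((i + 1 : ℕ) : ℂ) ^ (σ : ℂ) := by
  rw [invPow, Complex.real_smul, one_div, Real.inv_rpow (by positivity), Complex.ofReal_inv,
    Complex.ofReal_cpow (by positivity), mul_comm, div_eq_mul_inv]
  push_cast; rfl

theorem coe_unitAddCircle_eq_zero_iff (x : ℝ) : (x : UnitAddCircle) = 0 ↔ cis x = 1 := by
  rw [AddCircle.coe_eq_zero_iff, cis_eq_one_iff]
  refine exists_congr fun n ↦ ?_
  rw [zsmul_eq_mul, mul_one, eq_comm]
  norm_cast

/-- The Dirichlet series of the exponential zeta function converges conditionally at `s = 1`. -/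
theorem tendsto_sum_expZeta_one {x : ℝ} (hx : cis x ≠ 1) :
    Tendsto (fun n ↦ ∑ i ∈ Finset.range n, cis x ^ (i + 1) / ((i + 1 : ℕ) : ℂ)) atTop
      (𝓝 (expZeta x 1)) := by
  have hz := norm_cis_ofReal x
  have hx' : (x : UnitAddCircle) ≠ 0 := mt (coe_unitAddCircle_eq_zero_iff x).1 hx
  have hlim := tendsto_sum_partsSum hz hx le_rfl one_le_two
  simp only [invPow_smul, Complex.ofReal_one, Complex.cpow_one] at hlim
  suffices h : partsSum (cis x) 1 = expZeta x 1 by rwa [h] at hlim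
  -- For `σ > 1` both functions are the sum of the same convergent series; letting `σ` decrease to
  -- `1` uses continuity of each.
  have heq : ∀ᶠ σ : ℝ in 𝓝[>] (1 : ℝ), expZeta x (σ : ℂ) = partsSum (cis x) σ := by
    filter_upwards [Ioo_mem_nhdsGT (one_lt_two : (1 : ℝ) < 2)] with σ hσ
    have h1 := (hasSum_expZeta_succ x (s := σ) (by simpa using hσ.1)).tendsto_sum_nat
    have h2 := tendsto_sum_partsSum hz hx hσ.1.le hσ.2.le
    refine tendsto_nhds_unique h1 (h2.congr fun n ↦ Finset.sum_congr rfl fun i _ ↦ ?_)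
    rw [invPow_smul, cis_nat_mul]
  have hl1 : Tendsto (partsSum (cis x)) (𝓝[>] 1) (𝓝 (partsSum (cis x) 1)) := by
    have h := continuousOn_partsSum hz hx 1 ⟨le_rfl, one_le_two⟩
    rw [ContinuousWithinAt, nhdsWithin_Icc_eq_nhdsGE one_lt_two] at h
    exact h.mono_left (nhdsWithin_mono _ Set.Ioi_subset_Ici_self)
  have hl2 : Tendsto (fun σ : ℝ ↦ expZeta x (σ : ℂ)) (𝓝[>] 1) (𝓝 (expZeta x 1)) := by
    have h := (differentiable_expZeta_of_ne_zero hx').continuous.comp Complex.continuous_ofReal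
    simpa [Function.comp_def] using (h.tendsto 1).mono_left nhdsWithin_le_nhds
  exact tendsto_nhds_unique hl1 (hl2.congr' heq)

theorem tendsto_sum_expZeta_nat {x : ℝ} {m : ℕ} (hm : 1 ≤ m) (hx : m ≠ 1 ∨ cis x ≠ 1) :
    Tendsto (fun n ↦ ∑ i ∈ Finset.range n, cis x ^ (i + 1) / ((i : ℂ) + 1) ^ m) atTop
      (𝓝 (expZeta x m)) := by
  rcases hm.eq_or_lt with rfl | hm1
  · simpa using tendsto_sum_expZeta_one (hx.resolve_left (by simp))
  · have h := (hasSum_expZeta_succ x (s := m) (by simpa using hm1)).tendsto_sum_nat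
    refine h.congr fun n ↦ Finset.sum_congr rfl fun i _ ↦ ?_
    rw [cis_nat_mul, Complex.cpow_natCast]
    push_cast; rfl

theorem polylog_cis {x : ℝ} {m : ℕ} (hm : 1 ≤ m) (hx : m ≠ 1 ∨ cis x ≠ 1) :
    polylog m (cis x) = expZeta x m := by
  refine HasSum.tsum_eq ?_
  rw [HasSum, SummationFilter.conditional_filter_eq_map_range, tendsto_map'_iff]
  exact tendsto_sum_expZeta_nat hm hx

/-- At a real exponent, negating `x` conjugates every partial sum. -/
theorem expZeta_neg_nat {x : ℝ} {m : ℕ} (hm : 1 ≤ m) (hx : m ≠ 1 ∨ cis x ≠ 1) :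
    expZeta (-(x : UnitAddCircle)) m = (starRingEnd ℂ) (expZeta x m) := by
  have hconj := cis_neg_ofReal x
  have hx' : m ≠ 1 ∨ cis ((-x : ℝ) : ℂ) ≠ 1 := hx.imp_right fun h h' ↦ h (by
    rw [hconj] at h'
    simpa using congrArg (starRingEnd ℂ) h')
  have h1 := (Complex.continuous_conj.tendsto _).comp (tendsto_sum_expZeta_nat hm hx)
  have h2 := tendsto_sum_expZeta_nat hm hx'
  rw [AddCircle.coe_neg] at h2
  refine tendsto_nhds_unique h2 (h1.congr fun n ↦ ?_)
  rw [hconj]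
  simp

theorem one_sub_cis_mem_slitPlane {x : ℝ} (hx : cis x ≠ 1) :
    1 - cis x ∈ Complex.slitPlane := by
  have hz : (cis x).re ^ 2 + (cis x).im ^ 2 = 1 := by
    have := Complex.sq_norm (cis x)
    rw [norm_cis_ofReal, Complex.normSq_apply] at this
    nlinarith
  rw [Complex.mem_slitPlane_iff]
  by_contra! h
  simp only [Complex.sub_re, Complex.one_re, Complex.sub_im, Complex.one_im] at h
  have him : (cis x).im = 0 := by linarith [h.2]
  refine hx (Complex.ext ?_ him)
  rw [him] at hz
  rw [Complex.one_re]
  nlinarith [h.1]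

/-- Abel's limit theorem: the boundary series converges, so its sum is the radial limit of `-log(1 -
z)`, and `1 - cis x` stays off the branch cut. -/
theorem expZeta_one {x : ℝ} (hx : cis x ≠ 1) : expZeta x 1 = -Complex.log (1 - cis x) := by
  have hz := norm_cis_ofReal x
  have h1 : Tendsto (fun n ↦ ∑ i ∈ Finset.range n, cis x ^ i / (i : ℂ)) atTop
      (𝓝 (expZeta x 1)) := by
    rw [← tendsto_add_atTop_iff_nat 1]
    refine (tendsto_sum_expZeta_one hx).congr fun n ↦ ?_
    rw [Finset.sum_range_succ' _ n]
    simp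
  have h2 := Complex.tendsto_tsum_powerSeries_nhdsWithin_lt h1
  rw [tendsto_map'_iff] at h2
  have hslit := one_sub_cis_mem_slitPlane hx
  have h3 : Tendsto (fun r : ℝ ↦ -Complex.log (1 - cis x * r)) (𝓝[<] 1)
      (𝓝 (-Complex.log (1 - cis x))) := by
    have hc : ContinuousAt (fun r : ℝ ↦ -Complex.log (1 - cis x * r)) 1 := by
      refine ContinuousAt.neg (ContinuousAt.clog (by fun_prop) (by simpa using hslit))
    simpa using hc.tendsto.mono_left nhdsWithin_le_nhds
  refine tendsto_nhds_unique h2 (h3.congr' ?_)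
  filter_upwards [Ioo_mem_nhdsLT (zero_lt_one (α := ℝ))] with r hr
  have hlt : ‖cis x * r‖ < 1 := by
    rw [norm_mul, hz, one_mul, Complex.norm_real, Real.norm_of_nonneg hr.1.le]; exact hr.2
  rw [← (Complex.hasSum_taylorSeries_neg_log hlt).tsum_eq]
  simp only [Function.comp_apply]
  refine tsum_congr fun n ↦ ?_
  rw [mul_pow]; ring

/-! ### Hurwitz zeta values at nonpositive integers -/

/-- `1 - e^(2πix) = 2 sin(πx) e^(iπ(x-1/2))`, with positive modulus and an angle in the principal
range. -/
theorem arg_one_sub_cis {x : ℝ} (hx : x ∈ Set.Ioo 0 1) :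
    (1 - cis x).arg = Real.pi * (x - 1 / 2) := by
  have hpi := Real.pi_pos
  have h1 : 1 - cis x = (2 * Real.sin (Real.pi * x) : ℝ) *
      (Complex.cos (Real.pi * (x - 1 / 2) : ℝ) +
        Complex.sin (Real.pi * (x - 1 / 2) : ℝ) * Complex.I) := by
    have h2 : cis x = Complex.cos (2 * (Real.pi * x : ℝ)) +
        Complex.sin (2 * (Real.pi * x : ℝ)) * Complex.I := by
      rw [cis, ← Complex.exp_mul_I]; congr 1; push_cast; ring
    have h3 : ((Real.pi * (x - 1 / 2) : ℝ) : ℂ) = (Real.pi * x : ℝ) - Real.pi / 2 := by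
      push_cast; ring
    rw [h2, h3, Complex.cos_sub_pi_div_two, Complex.sin_sub_pi_div_two, Complex.cos_two_mul,
      Complex.sin_two_mul, Complex.cos_sq']
    push_cast
    ring
  have hsin : 0 < 2 * Real.sin (Real.pi * x) :=
    mul_pos two_pos (Real.sin_pos_of_pos_of_lt_pi (mul_pos hpi hx.1) (by nlinarith [hx.2]))
  rw [h1, Complex.arg_mul_cos_add_sin_mul_I hsin ⟨by nlinarith [hx.1], by nlinarith [hx.2]⟩]

theorem cis_ne_one {x : ℝ} (hx : x ∈ Set.Ioo 0 1) : cis x ≠ 1 := by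
  rw [Ne, cis_eq_one_iff]
  rintro ⟨n, hn⟩
  have hn' : x = n := by exact_mod_cast hn
  have h0 : (0 : ℝ) < n := hn' ▸ hx.1
  have h1 : (n : ℝ) < 1 := hn' ▸ hx.2
  norm_cast at h0 h1
  omega

/-- The functional equation at `s = 1` reduces the value to `Im (expZeta x 1) / π`, and this
imaginary part is `-arg(1 - e^(2πix))`. -/
theorem hurwitzZeta_apply_zero {x : ℝ} (hx : x ∈ Set.Ioo 0 1) :
    hurwitzZeta x 0 = 1 / 2 - x := by
  have hne := cis_ne_one hx
  have hx0 : (x : UnitAddCircle) ≠ 0 := mt (coe_unitAddCircle_eq_zero_iff x).1 hne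
  have h := hurwitzZeta_one_sub (x : UnitAddCircle) (s := 1)
    (fun n h ↦ by
      have := congrArg Complex.re h
      simp at this
      have hn : (0 : ℝ) ≤ n := Nat.cast_nonneg n
      linarith) (.inl hx0)
  have hneg := expZeta_neg_nat (x := x) le_rfl (.inr hne)
  rw [Nat.cast_one] at hneg
  have hlog : expZeta x 1 - (starRingEnd ℂ) (expZeta x 1) =
      -(2 * (Real.pi * (x - 1 / 2)) * Complex.I) := by
    rw [Complex.sub_conj, expZeta_one hne, Complex.neg_im, Complex.log_im, arg_one_sub_cis hx]
    push_cast; ring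
  have e1 : Complex.exp (-Real.pi * Complex.I * 1 / 2) = -Complex.I := by
    rw [show -(Real.pi : ℂ) * Complex.I * 1 / 2 = -((Real.pi : ℂ) / 2 * Complex.I) by ring,
      Complex.exp_neg, Complex.exp_pi_div_two_mul_I, Complex.inv_I]
  have e2 : Complex.exp (Real.pi * Complex.I * 1 / 2) = Complex.I := by
    rw [show (Real.pi : ℂ) * Complex.I * 1 / 2 = (Real.pi : ℂ) / 2 * Complex.I by ring,
      Complex.exp_pi_div_two_mul_I]
  have hpi : (Real.pi : ℂ) ≠ 0 := by exact_mod_cast Real.pi_ne_zero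
  rw [sub_self, hneg, e1, e2, Complex.Gamma_one, Complex.cpow_neg_one, mul_one] at h
  rw [h, show -Complex.I * expZeta x 1 + Complex.I * (starRingEnd ℂ) (expZeta x 1) =
    -Complex.I * (expZeta x 1 - (starRingEnd ℂ) (expZeta x 1)) by ring, hlog]
  field_simp
  linear_combination (2 * x - 1 : ℂ) * Complex.I_sq

theorem hurwitzZeta_neg_nat_rat {r : ℚ} (hr : r ∈ Set.Icc 0 1) {n : ℕ}
    (h : n ≠ 0 ∨ r ∈ Set.Ioo 0 1) :
    hurwitzZeta ((r : ℝ) : UnitAddCircle) (-(n : ℂ)) =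
      -(((Polynomial.bernoulli (n + 1)).eval r : ℚ) : ℂ) / (n + 1) := by
  rcases eq_or_ne n 0 with rfl | hn
  · have hr' := h.resolve_left (by simp)
    have hx : (r : ℝ) ∈ Set.Ioo (0 : ℝ) 1 := ⟨by exact_mod_cast hr'.1, by exact_mod_cast hr'.2⟩
    rw [Nat.cast_zero, neg_zero, hurwitzZeta_apply_zero hx, zero_add, Polynomial.bernoulli_one]
    simp
  · have hx : (r : ℝ) ∈ Set.Icc (0 : ℝ) 1 := ⟨by exact_mod_cast hr.1, by exact_mod_cast hr.2⟩
    rw [hurwitzZeta_neg_nat hn hx]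
    have : ((r : ℝ) : ℂ) = algebraMap ℚ ℂ r := by simp
    rw [this, Polynomial.eval_map, Polynomial.eval₂_at_apply]
    simp
    ring

/-- Reflection of Bernoulli polynomials under `r ↦ 1 - r`. For `n = 0` the endpoints must be
excluded, since `B_1(0)` and `B_1(1)` differ although `0` and `1` agree on the circle. -/
theorem hurwitzZeta_neg_neg_nat {r : ℚ} (hr : r ∈ Set.Icc 0 1) {n : ℕ}
    (h : n ≠ 0 ∨ r ∈ Set.Ioo 0 1) :
    hurwitzZeta (-((r : ℝ) : UnitAddCircle)) (-(n : ℂ)) =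
      (-1) ^ (n + 1) * hurwitzZeta ((r : ℝ) : UnitAddCircle) (-(n : ℂ)) := by
  have h1 : -((r : ℝ) : UnitAddCircle) = (((1 - r : ℚ) : ℝ) : UnitAddCircle) := by
    rw [← sub_eq_zero, ← AddCircle.coe_neg, ← AddCircle.coe_sub, AddCircle.coe_eq_zero_iff]
    exact ⟨-1, by push_cast; rw [zsmul_eq_mul]; push_cast; ring⟩
  rw [h1, hurwitzZeta_neg_nat_rat (r := 1 - r) ⟨by linarith [hr.2], by linarith [hr.1]⟩
    (h.imp_right fun h ↦ ⟨by linarith [h.2], by linarith [h.1]⟩), hurwitzZeta_neg_nat_rat hr h,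
    Polynomial.bernoulli_eval_one_sub]
  push_cast
  ring

/-- The functional equation of the Hurwitz zeta function at positive integers. -/
theorem hurwitzZeta_one_sub_nat (B : UnitAddCircle) {l : ℕ} (hl : 1 ≤ l) (h : B ≠ 0 ∨ l ≠ 1) :
    hurwitzZeta B (1 - l) = ((2 * Real.pi : ℂ) ^ l)⁻¹ * Complex.Gamma l * ((-Complex.I) ^ l *
      (expZeta B l + (-1) ^ l * expZeta (-B) l)) := by
  have e1 : Complex.exp (-Real.pi * Complex.I * l / 2) = (-Complex.I) ^ l := by
    rw [show -(Real.pi : ℂ) * Complex.I * l / 2 = l * -((Real.pi : ℂ) / 2 * Complex.I) by ring,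
      Complex.exp_nat_mul, Complex.exp_neg, Complex.exp_pi_div_two_mul_I, Complex.inv_I]
  have e2 : Complex.exp (Real.pi * Complex.I * l / 2) = (-Complex.I) ^ l * (-1) ^ l := by
    rw [show (Real.pi : ℂ) * Complex.I * l / 2 = l * ((Real.pi : ℂ) / 2 * Complex.I) by ring,
      Complex.exp_nat_mul, Complex.exp_pi_div_two_mul_I, ← mul_pow]
    simp
  rw [hurwitzZeta_one_sub B (fun n hn ↦ ?_) (h.imp_right fun h ↦ by exact_mod_cast h), e1, e2,
    Complex.cpow_neg, Complex.cpow_natCast]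
  · ring
  · have h1 : ((l + n : ℕ) : ℂ) = 0 := by push_cast; rw [hn]; ring
    have h2 : l + n = 0 := by exact_mod_cast h1
    omega

theorem clausen_neg {x : ℝ} {m : ℕ} (hm : 1 ≤ m) (hx : m ≠ 1 ∨ cis x ≠ 1) :
    clausen m (-(2 * Real.pi * x)) = (-1) ^ (m + 1) * clausen m (2 * Real.pi * x) := by
  have h1 : Complex.exp ((2 * Real.pi * x : ℝ) * Complex.I) = cis x := by
    rw [cis]; congr 1; push_cast; ring
  have h2 : Complex.exp ((-(2 * Real.pi * x) : ℝ) * Complex.I) = cis ((-x : ℝ) : ℂ) := by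
    rw [cis]; congr 1; push_cast; ring
  have hconj := cis_neg_ofReal x
  have hx' : m ≠ 1 ∨ cis ((-x : ℝ) : ℂ) ≠ 1 := hx.imp_right fun h h' ↦ h (by
    rw [hconj] at h'
    simpa using congrArg (starRingEnd ℂ) h')
  rw [clausen, clausen, h1, h2, polylog_cis hm hx, polylog_cis hm hx', AddCircle.coe_neg,
    expZeta_neg_nat hm hx]
  rcases Nat.even_or_odd m with h | h
  · rw [if_neg (Nat.not_odd_iff_even.2 h), if_neg (Nat.not_odd_iff_even.2 h), h.add_one.neg_one_pow,
      Complex.conj_im, neg_one_mul]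
  · rw [if_pos h, if_pos h, h.add_one.neg_one_pow, Complex.conj_re, one_mul]

/-! ### The completed `L`-values -/

section Values

variable {N : ℕ} (a b : ℤ) {k : ℕ}

/-- All powers of `N` cancel at `s = l`, so the value depends on `N` only through `a/N` and `b/N`.
-/
theorem completedL_eisH_eq_eisDirichlet (hN : N ≠ 0) (hk : 2 ≤ k)
    (h2 : k = 2 → ¬ ((N : ℤ) ∣ a ∧ (N : ℤ) ∣ b)) {l : ℕ} (hl : 1 ≤ l) (hlk : l < k)
    (hs1 : l ≠ 1 ∨ ((b / N : ℝ) : UnitAddCircle) ≠ 0) :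
    completedL (eisH N a b k) k l =
      (-2 * Real.pi * Complex.I) ^ k / (k - 1).factorial * Complex.I ^ l * Complex.Gamma l *
        ((2 * Real.pi : ℂ) ^ l)⁻¹ * eisDirichlet (a / N : ℝ) (b / N : ℝ) k l := by
  have hN' : (N : ℂ) ≠ 0 := by exact_mod_cast hN
  have hG : Complex.Gamma l ≠ 0 :=
    Complex.Gamma_ne_zero_of_re_pos (by simpa using Nat.pos_of_ne_zero (show l ≠ 0 by omega))
  have h := Λ_eisPair hN a b hk h2 (s := l) (by exact_mod_cast (show l ≠ 0 by omega))
    (by exact_mod_cast hlk.ne) (hs1.imp_left fun h ↦ by exact_mod_cast h)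
  rw [inv_mul_eq_iff_eq_mul₀ hG] at h
  rw [completedL_eisH_eq_Λ a b hN hk h2 hl hlk, h]
  have hpow : (N : ℂ) ^ ((k : ℂ) - 1 - l) = (N : ℂ) ^ (k - 1) / (N : ℂ) ^ l := by
    rw [Complex.cpow_sub _ _ hN', Complex.cpow_natCast, ← Nat.cast_one, ← Nat.cast_sub (by omega),
      Complex.cpow_natCast]
  have hpi : (Real.pi : ℂ) ≠ 0 := by exact_mod_cast Real.pi_ne_zero
  rw [hpow, Complex.cpow_neg, Complex.cpow_natCast, lipschitzConst]
  push_cast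
  rw [div_pow]
  field_simp

/-- The value of the Dirichlet series when the Hurwitz zeta values have a parity. -/
theorem eisDirichlet_of_parity {A B : UnitAddCircle} {l : ℕ} (hlk : l < k)
    (hA : hurwitzZeta (-A) (-((k - l - 1 : ℕ) : ℂ)) =
      (-1) ^ (k - l) * hurwitzZeta A (-((k - l - 1 : ℕ) : ℂ))) :
    eisDirichlet A B k l = hurwitzZeta A (-((k - l - 1 : ℕ) : ℂ)) *
      (expZeta B l + (-1) ^ l * expZeta (-B) l) := by
  obtain ⟨q, rfl⟩ : ∃ q, k = l + (q + 1) := ⟨k - l - 1, by omega⟩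
  have hs : ((l : ℂ) - (l + (q + 1) : ℕ) + 1) = -((q : ℕ) : ℂ) := by push_cast; ring
  rw [show l + (q + 1) - l - 1 = q by omega, show l + (q + 1) - l = q + 1 by omega] at *
  rw [eisDirichlet, hs, hA]
  have : (-1 : ℂ) ^ (l + (q + 1)) * (-1) ^ (q + 1) = (-1) ^ l := by
    rw [pow_add, mul_assoc, ← mul_pow]; norm_num
  linear_combination (expZeta (-B) l * hurwitzZeta A (-(q : ℂ))) * this

theorem coe_div_ne_zero {b : ℕ} (hb : b < N) (hb0 : b ≠ 0) :
    ((b / N : ℝ) : UnitAddCircle) ≠ 0 := by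
  have hN' : (0 : ℝ) < N := by exact_mod_cast (Nat.zero_le b).trans_lt hb
  have hb' : (0 : ℝ) < b := by exact_mod_cast Nat.pos_of_ne_zero hb0
  exact mt (coe_unitAddCircle_eq_zero_iff _).1
    (cis_ne_one ⟨by positivity, (div_lt_one hN').2 (by exact_mod_cast hb)⟩)

/-- The two exclusions are the places where the method breaks: the first is where the Hurwitz factor
loses its parity, the second is the pole of `expZeta`. Elsewhere the value is a product of Hurwitz
zeta values at `l - k + 1` and `1 - l`. -/
theorem completedL_eisH_eq_bernoulliAt {a b : ℕ} (ha : a < N) (hb : b < N) (hk : 2 ≤ k)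
    (h2 : k = 2 → ¬ (a = 0 ∧ b = 0)) {l : ℕ} (hl : 1 ≤ l) (hlk : l < k)
    (hal : ¬ (a = 0 ∧ l = k - 1)) (hbl : ¬ (b = 0 ∧ l = 1)) :
    completedL (eisH N a b k) k l =
        (-1) ^ (k + l) * ((2 * Real.pi * Complex.I) ^ k / ((k - 1).factorial : ℂ)) *
          (bernoulliAt (k - l) a N / ((k : ℂ) - l)) * (bernoulliAt l b N / (l : ℂ)) := by
  have hN : N ≠ 0 := by omega
  have hNq : (0 : ℚ) < N := by exact_mod_cast Nat.pos_of_ne_zero hN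
  have hdvd {c : ℕ} (hc : c < N) (h : (N : ℤ) ∣ c) : c = 0 :=
    Nat.eq_zero_of_dvd_of_lt (by exact_mod_cast h) hc
  have hIcc {c : ℕ} (hc : c < N) : (c / N : ℚ) ∈ Set.Icc 0 1 :=
    ⟨by positivity, (div_le_one hNq).2 (by exact_mod_cast hc.le)⟩
  have hIoo {c : ℕ} (hc : c < N) (hc0 : c ≠ 0) : (c / N : ℚ) ∈ Set.Ioo 0 1 := by
    have : (0 : ℚ) < c := by exact_mod_cast Nat.pos_of_ne_zero hc0
    exact ⟨by positivity, (div_lt_one hNq).2 (by exact_mod_cast hc)⟩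
  have hcast (c : ℕ) : ((c / N : ℚ) : ℝ) = (c / N : ℝ) := by push_cast; rfl
  have hlb : l ≠ 1 ∨ ((b / N : ℝ) : UnitAddCircle) ≠ 0 := by
    by_cases h : l = 1
    · exact .inr (coe_div_ne_zero hb fun h' ↦ hbl ⟨h', h⟩)
    · exact .inl h
  have hq : k - l - 1 ≠ 0 ∨ (a / N : ℚ) ∈ Set.Ioo 0 1 := by
    by_cases h : k - l - 1 = 0
    · exact .inr (hIoo ha fun h' ↦ hal ⟨h', by omega⟩)
    · exact .inl h
  have hp : l - 1 ≠ 0 ∨ (b / N : ℚ) ∈ Set.Ioo 0 1 := by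
    by_cases h : l - 1 = 0
    · exact .inr (hIoo hb fun h' ↦ hbl ⟨h', by omega⟩)
    · exact .inl h
  have hA := hurwitzZeta_neg_nat_rat (hIcc ha) hq
  have hA' := hurwitzZeta_neg_neg_nat (hIcc ha) hq
  have hB := hurwitzZeta_neg_nat_rat (hIcc hb) hp
  have hBE := hurwitzZeta_one_sub_nat ((b / N : ℝ) : UnitAddCircle) hl hlb.symm
  rw [hcast] at hA hA' hB
  rw [show k - l - 1 + 1 = k - l by omega] at hA hA'
  rw [show l - 1 + 1 = l by omega, show -((l - 1 : ℕ) : ℂ) = 1 - l by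
    rw [Nat.cast_sub hl]; push_cast; ring] at hB
  have h := completedL_eisH_eq_eisDirichlet (a : ℤ) (b : ℤ) hN hk
    (fun h h' ↦ h2 h ⟨hdvd ha h'.1, hdvd hb h'.2⟩) hl hlk (by simpa using hlb)
  simp only [Int.cast_natCast] at h
  have hI : Complex.I ^ l = (-1) ^ l * (-Complex.I) ^ l := by rw [← mul_pow]; simp
  have hneg : (-2 * Real.pi * Complex.I) ^ k = (-1) ^ k * (2 * Real.pi * Complex.I) ^ k := by
    rw [← mul_pow]; ring
  have hl1 : ((l - 1 : ℕ) : ℂ) + 1 = l := by rw [Nat.cast_sub hl]; push_cast; ring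
  have hkl1 : ((k - l - 1 : ℕ) : ℂ) + 1 = k - l := by
    rw [show k - l - 1 = k - (l + 1) by omega, Nat.cast_sub (by omega)]; push_cast; ring
  rw [hl1] at hB
  rw [hkl1] at hA
  rw [h, eisDirichlet_of_parity hlk hA', hA, hI, hneg, pow_add, bernoulliAt, bernoulliAt]
  rw [hBE] at hB
  linear_combination ((-1) ^ k * (2 * Real.pi * Complex.I) ^ k / ((k - 1).factorial : ℂ)) *
    (-1) ^ l * (-(((Polynomial.bernoulli (k - l)).eval ((a : ℚ) / N) : ℚ) : ℂ) / (k - l)) * hB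

/-- With `A = 0` both Hurwitz factors are `ζ(0) = -1/2`, leaving `E + (-1)^k conj E`; the factor `i`
in the odd case comes from `E - conj E = 2i Im E`. Allowing any integer `b` makes the result
applicable to `(0,-a)`. -/
theorem completedL_eisH_zero_left (b : ℤ) (hN : N ≠ 0) (hk : 2 ≤ k) (hb : k = 2 → ¬ (N : ℤ) ∣ b) :
    completedL (eisH N 0 b k) k (k - 1) =
        2 * Real.pi * Complex.I / ((k : ℂ) - 1) * Complex.I ^ (k % 2) *
          (clausen (k - 1) (2 * Real.pi * b / N) : ℂ) := by
  have hcis : k - 1 ≠ 1 ∨ cis ((b / N : ℝ) : ℂ) ≠ 1 := by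
    by_cases h : k - 1 = 1
    · refine .inr fun h' ↦ hb (by omega) ((cis_int_div_eq_one_iff hN b).1 ?_)
      push_cast at h'
      exact h'
    · exact .inl h
  have h := completedL_eisH_eq_eisDirichlet 0 b hN hk (fun h h' ↦ hb h h'.2)
    (show 1 ≤ k - 1 by omega) (by omega) (hcis.imp_right (mt (coe_unitAddCircle_eq_zero_iff _).1))
  have hconj := expZeta_neg_nat (show 1 ≤ k - 1 by omega) hcis
  have hpoly := polylog_cis (show 1 ≤ k - 1 by omega) hcis
  have harg : Complex.exp ((2 * Real.pi * b / N : ℝ) * Complex.I) = cis ((b / N : ℝ) : ℂ) := by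
    rw [cis]; congr 1; push_cast; ring
  obtain ⟨n, rfl⟩ : ∃ n, k = n + 2 := ⟨k - 2, by omega⟩
  rw [show n + 2 - 1 = n + 1 by omega] at *
  have hzero : (((0 : ℤ) / N : ℝ) : UnitAddCircle) = 0 := by
    rw [Int.cast_zero, zero_div]; rfl
  have hs : ((n + 1 : ℕ) : ℂ) - (n + 2 : ℕ) + 1 = 0 := by push_cast; ring
  have hpi : (Real.pi : ℂ) ≠ 0 := by exact_mod_cast Real.pi_ne_zero
  have hfac : ((n.factorial : ℕ) : ℂ) ≠ 0 := by exact_mod_cast n.factorial_ne_zero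
  have hn1 : (n : ℂ) + 1 ≠ 0 := by exact_mod_cast n.succ_ne_zero
  have hpow : (-2 * Real.pi * Complex.I) ^ (n + 2) * Complex.I ^ (n + 1) =
      -(2 * Real.pi * Complex.I) * (2 * Real.pi : ℂ) ^ (n + 1) := by
    rw [pow_succ _ (n + 1), mul_right_comm, ← mul_pow,
      show -2 * (Real.pi : ℂ) * Complex.I * Complex.I = 2 * Real.pi by
        linear_combination (-2 * (Real.pi : ℂ)) * Complex.I_sq]
    ring
  generalize hE : expZeta ((b / N : ℝ) : UnitAddCircle) ((n + 1 : ℕ) : ℂ) = E at hconj hpoly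
  have hmain : completedL (eisH N 0 b (n + 2)) (n + 2) (n + 1) =
      2 * Real.pi * Complex.I / (n + 1) * ((E + (-1) ^ n * (starRingEnd ℂ) E) / 2) := by
    rw [h, eisDirichlet, hzero, hs, neg_zero, hconj, hE, hurwitzZeta_zero, riemannZeta_zero,
      Nat.factorial_succ, Nat.cast_succ n, Complex.Gamma_nat_eq_factorial]
    push_cast
    rw [div_mul_eq_mul_div, hpow]
    field_simp
    ring
  rw [hmain, show (((n + 2 : ℕ) : ℂ) - 1) = n + 1 by push_cast; ring,
    mul_assoc _ (Complex.I ^ _), Nat.add_mod_right,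
    clausen, harg, hpoly]
  congr 1
  rcases Nat.even_or_odd n with hn | hn
  · rw [if_pos hn.add_one, hn.neg_one_pow, one_mul, Complex.add_conj, Nat.even_iff.1 hn]
    push_cast
    ring
  · rw [if_neg (Nat.not_odd_iff_even.2 hn.add_one), hn.neg_one_pow, neg_one_mul, ← sub_eq_add_neg,
      Complex.sub_conj, Nat.odd_iff.1 hn]
    push_cast
    ring

end Values

end EisensteinLValues

theorem theorem3p1 (N a b k l : ℕ) (ha : a < N) (hb : b < N)
    (hk : 1 < k) (hl : 1 ≤ l) (hlk : l < k)
    (h2 : k = 2 → ¬ (a = 0 ∧ b = 0)) :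
    EisensteinLValues.CompletedLConverges (EisensteinLValues.eisH N a b k) k l ∧
    (a = 0 → l = k - 1 →
      EisensteinLValues.completedL (EisensteinLValues.eisH N a b k) k l =
        2 * Real.pi * Complex.I / ((k : ℂ) - 1) * Complex.I ^ (k % 2) *
          (EisensteinLValues.clausen (k - 1) (2 * Real.pi * b / N) : ℂ)) ∧
    (b = 0 → l = 1 →
      EisensteinLValues.completedL (EisensteinLValues.eisH N a b k) k l =
        (-1) ^ (k + 1) * (2 * Real.pi * Complex.I / ((k : ℂ) - 1)) * Complex.I ^ (k % 2) *
          (EisensteinLValues.clausen (k - 1) (2 * Real.pi * a / N) : ℂ)) ∧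
    (¬ (a = 0 ∧ l = k - 1) → ¬ (b = 0 ∧ l = 1) →
      EisensteinLValues.completedL (EisensteinLValues.eisH N a b k) k l =
        (-1) ^ (k + l) * ((2 * Real.pi * Complex.I) ^ k / ((k - 1).factorial : ℂ)) *
          (EisensteinLValues.bernoulliAt (k - l) a N / ((k : ℂ) - l)) *
          (EisensteinLValues.bernoulliAt l b N / (l : ℂ))) := by
  have hN : N ≠ 0 := by omega
  have hdvd {c : ℕ} (hc : c < N) (h : (N : ℤ) ∣ c) : c = 0 :=
    Nat.eq_zero_of_dvd_of_lt (by exact_mod_cast h) hc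
  have h2' : k = 2 → ¬ ((N : ℤ) ∣ a ∧ (N : ℤ) ∣ b) := fun h h' ↦
    h2 h ⟨hdvd ha h'.1, hdvd hb h'.2⟩
  refine ⟨EisensteinLValues.completedLConverges_eisH a b hN hk h2' l, ?_, ?_,
    EisensteinLValues.completedL_eisH_eq_bernoulliAt ha hb hk h2 hl hlk⟩
  · rintro rfl rfl
    exact_mod_cast EisensteinLValues.completedL_eisH_zero_left b hN hk
      fun h h' ↦ h2 h ⟨rfl, hdvd hb h'⟩
  · rintro rfl rfl
    have h3 := EisensteinLValues.completedL_eisH_symm a 0 hN hk (by exact_mod_cast h2') le_rfl hlk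
    have h4 := EisensteinLValues.completedL_eisH_zero_left (-a) hN hk
      fun h h' ↦ h2 h ⟨hdvd ha ((dvd_neg).1 h'), rfl⟩
    -- The symmetry at `l = 1` moves the pole case to `(0,-a)` at `k - 1`; the parity of the Clausen
    -- function then restores `a` and contributes the sign `(-1)^k`.
    have h5 : EisensteinLValues.completedL (EisensteinLValues.eisH N a 0 k) k 1 =
        -EisensteinLValues.completedL (EisensteinLValues.eisH N 0 (-a) k) k (k - 1) := by
      rw [h3]; ring
    have h6 := EisensteinLValues.clausen_neg (m := k - 1) (x := (a / N : ℝ)) (by omega) (by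
      by_cases hk1 : k - 1 = 1
      · refine .inr fun h' ↦ h2 (by omega) ⟨hdvd ha ?_, rfl⟩
        refine (EisensteinLValues.cis_int_div_eq_one_iff hN a).1 ?_
        push_cast at h' ⊢
        exact h'
      · exact .inl hk1)
    rw [show 2 * Real.pi * ((-a : ℤ) : ℝ) / N = -(2 * Real.pi * (a / N : ℝ)) by push_cast; ring,
      h6, show k - 1 + 1 = k by omega, ← mul_div_assoc] at h4
    rw [Nat.cast_zero, h5, h4]
    push_cast
    ring
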